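/- **Theorem.** Let $M$ be an $m$-dimensional smooth Riemannian manifold, with inner product $\langle\cdot,\cdot\rangle_x$ and norm $\|\cdot\|_x$ on $T_xM$, and let $R:TM\to M$ be a $C^2$ retraction: $R$ is of class $C^2$ and, for every $x\in M$, the restriction $R_x=R|_{T_xM}$ satisfies $R_x(0_x)=x$ and $dR_x(0_x)=\mathrm{id}_{T_xM}$. Let $(\Omega,\mu)$ be a probability space and let $f:M\times\Omega\to\mathbb R$ be such that $f(x,\cdot)$ is measurable for every $x$. Write $\nabla_M f(x,\omega)$ for the Riemannian gradient of $f(\cdot,\omega)$ at $x$, and $\nabla f_{x,\omega}$ for the gradient of $f_{x,\omega}:=f(R_x(\cdot),\omega)$ on the inner product space $T_xM$. Assume: * $f(\cdot,\omega)$ is differentiable on $M$ for every $\omega\in\Omega$; * for every compact $K\subset M$, both $|f|$ and $\|\nabla_M f\|$ are bounded on $K\times\Omega$; * $f$ has locally $R$-Lipschitz gradient: for every compact $K\subset M$ and every $r>0$ there is $C_{K,r}>0$ with $\|\nabla f_{x,\omega}(v)-\nabla f_{x,\omega}(0_x)\|_x\le C_{K,r}\|v\|_x$ for all $x\in K$,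 all $v\in T_xM$ with $\|v\|_x\le r$, and all $\omega\in\Omega$. Let $F(x)=\int_\Omega f(x,\omega)\,d\mu(\omega)$. Let $\kappa>0$, $\rho_0<\rho_1$ and let $\rho:M\to\mathbb R$ be a $\kappa$-confinement of $f$ with levels $\rho_0,\rho_1$, that is, a $C^2$ function such that $\{\rho\le c\}$ is compact for every $c\in\mathbb R$ and, for all $s\in[0,\kappa]$ and $\omega\in\Omega$, * $\rho\big(R_x(-s\nabla_M f(x,\omega))\big)\le\rho_1$ whenever $\rho(x)\le\rho_0$; * $\langle\nabla\rho(x),\nabla_M f(x,\omega)\rangle_x\ge\frac{\kappa}{2}\big|\mathrm{Hess}(\rho\circ R_x)|_{-s\nabla_M f(x,\omega)}\big(\nabla_M f(x,\omega),\nabla_M f(x,\omega)\big)\big|$ whenever $\rho_0\le\rho(x)\le\rho_1$, where $\mathrm{Hess}(\rho\circ R_x)$ is the Hessian on the inner product space $T_xM$. Put $K_1=\{x\in M:\rho(x)\le\rho_1\}$ and let $x_0\in K_1$ be a fixed point. Let $\omega_0,\omega_1,\dots$ be independent $\Omega$-valued random variables with common law $\mu$. Let $\alpha,\beta>0$ and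 $0<\varepsilon\le\frac12$ satisfy $\alpha/\beta^{\frac12+\varepsilon}\le\kappa$, and define, for $t\ge0$, $$x_{t+1}=R_{x_t}\big(-\eta_t\nabla_M f(x_t,\omega_t)\big),\qquad \eta_t=\frac{\alpha}{\big(\beta+\sum_{s=0}^{t-1}\|\nabla_M f(x_s,\omega_s)\|_{x_s}^2\big)^{\frac12+\varepsilon}}.$$ Then: * $K_1$ is compact and every trajectory $(x_t)_{t\ge0}$ is contained in $K_1$; in particular every trajectory has a convergent subsequence (with limit in $K_1$). * $F$ is differentiable on $M$, and $\|\nabla F(x_t)\|_{x_t}\to0$ almost surely. * Almost surely, every limit point of $(x_t)_{t\ge0}$ is a stationary point of $F$, i.e. a zero of $\nabla F$. -/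

import Mathlib

open Bundle Manifold MeasureTheory ProbabilityTheory Filter Topology
open scoped ContDiff

noncomputable section

namespace AdaSGD

variable {m : ℕ} {M : Type*} [TopologicalSpace M] [ChartedSpace (EuclideanSpace ℝ (Fin m)) M]
  [RiemannianBundle (fun x : M => TangentSpace (𝓡 m) x)]
  {Ω : Type*}

instance completeSpace_tangentSpace (x : M) : CompleteSpace (TangentSpace (𝓡 m) x) := by
  have : FiniteDimensional ℝ (TangentSpace (𝓡 m) x) :=
    inferInstanceAs (FiniteDimensional ℝ (EuclideanSpace ℝ (Fin m)))
  exact FiniteDimensional.complete ℝ (TangentSpace (𝓡 m) x)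

/-- The map `R_x : T_x M → M`, the restriction of `R : TM → M` to the tangent space at `x`. -/
def retrAt (R : TangentBundle (𝓡 m) M → M) (x : M) (v : TangentSpace (𝓡 m) x) : M :=
  R ⟨x, v⟩

/-- `R : TM → M` is a `C^k` retraction (for `1 ≤ k`): it is of class `C^k`, `R_x(0_x) = x`, and
the differential of `R_x` at `0_x` is the identity of `T_x M`.  The last condition is written as an
equality of points of `TM`, since the value of the differential of `R_x` at `0_x` has type
`T_{R_x(0_x)} M`. -/
structure IsRetraction [IsManifold (𝓡 m) ∞ M] (k : WithTop ℕ∞)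
    (R : TangentBundle (𝓡 m) M → M) : Prop where
  contMDiff : ContMDiff (𝓡 m).tangent (𝓡 m) k R
  apply_zero : ∀ x : M, retrAt R x 0 = x
  mfderiv_zero : ∀ (x : M) (v : TangentSpace (𝓡 m) x),
    (⟨retrAt R x 0, mfderiv 𝓘(ℝ, TangentSpace (𝓡 m) x) (𝓡 m) (retrAt R x) 0 v⟩ :
      TangentBundle (𝓡 m) M) = ⟨x, v⟩

variable (m) in
/-- The Riemannian gradient of `h : M → ℝ` at `x`: the vector of `T_x M` dual to the differential
of `h` at `x` with respect to the Riemannian inner product. -/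
def mgrad (h : M → ℝ) (x : M) : TangentSpace (𝓡 m) x :=
  (InnerProductSpace.toDual ℝ (TangentSpace (𝓡 m) x)).symm (mfderiv (𝓡 m) 𝓘(ℝ, ℝ) h x)

variable (m) in
/-- `x` is a stationary point of `h`: `h` is differentiable at `x` and its gradient vanishes. -/
def IsStationaryPoint (h : M → ℝ) (x : M) : Prop :=
  MDifferentiableAt (𝓡 m) 𝓘(ℝ, ℝ) h x ∧ mgrad m h x = 0

/-- The Hessian at `w` of a function `h` on a real vector space, as a bilinear form: the second
derivative of `h`. -/
def hess {V : Type*} [NormedAddCommGroup V] [NormedSpace ℝ V] (h : V → ℝ) (w u v : V) : ℝ :=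
  fderiv ℝ (fderiv ℝ h) w u v

variable (m) in
/-- A random function `f` on `M` is first-order differentiable in the `M`-direction. -/
def DifferentiableInM (f : M → Ω → ℝ) : Prop :=
  ∀ a : Ω, MDifferentiable (𝓡 m) 𝓘(ℝ, ℝ) (fun x => f x a)

/-- A real function on `M × Ω` is locally bounded on `M`: bounded on `K × Ω` for every
compact `K`. -/
def LocallyBounded (f : M → Ω → ℝ) : Prop :=
  ∀ K : Set M, IsCompact K → ∃ C : ℝ, 0 < C ∧ ∀ x ∈ K, ∀ a : Ω, |f x a| ≤ C

/-- `f` has locally `R`-Lipschitz gradient in the `M`-direction.  Here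
`gradient (fun u => f (retrAt R x u) a)` is the gradient of `f_{x,a} = f(R_x(·), a)` on the inner
product space `T_x M`. -/
def LocallyRLipschitzGradient (R : TangentBundle (𝓡 m) M → M) (f : M → Ω → ℝ) : Prop :=
  ∀ K : Set M, IsCompact K → ∀ r : ℝ, 0 < r → ∃ C : ℝ, 0 < C ∧
    ∀ x ∈ K, ∀ v : TangentSpace (𝓡 m) x, ‖v‖ ≤ r → ∀ a : Ω,
      ‖gradient (fun u => f (retrAt R x u) a) v - gradient (fun u => f (retrAt R x u) a) 0‖
        ≤ C * ‖v‖

/-- `ρ` is a `κ`-confinement of `f`, and `ρ₀ < ρ₁` are levels for which the two defining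
inequalities hold. -/
structure IsConfinementWith (R : TangentBundle (𝓡 m) M → M) (f : M → Ω → ℝ) (κ : ℝ) (ρ : M → ℝ)
    (ρ₀ ρ₁ : ℝ) : Prop where
  contMDiff : ContMDiff (𝓡 m) 𝓘(ℝ, ℝ) 2 ρ
  isCompact_sublevel : ∀ c : ℝ, IsCompact {x : M | ρ x ≤ c}
  lt : ρ₀ < ρ₁
  step_le : ∀ s ∈ Set.Icc (0 : ℝ) κ, ∀ a : Ω, ∀ x : M, ρ x ≤ ρ₀ →
    ρ (retrAt R x (-(s • mgrad m (fun y => f y a) x))) ≤ ρ₁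
  hess_le : ∀ s ∈ Set.Icc (0 : ℝ) κ, ∀ a : Ω, ∀ x : M, ρ₀ ≤ ρ x → ρ x ≤ ρ₁ →
    κ / 2 * |hess (fun u => ρ (retrAt R x u)) (-(s • mgrad m (fun y => f y a) x))
        (mgrad m (fun y => f y a) x) (mgrad m (fun y => f y a) x)|
      ≤ inner ℝ (mgrad m ρ x) (mgrad m (fun y => f y a) x)

variable (m) in
/-- The adaptive step size
`η_t = α / (β + ∑_{s < t} ‖∇_M f(x_s, ω_s)‖²)^{1/2 + ε}` along a sequence `x` of points of `M` and a
sequence `w` of samples. -/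
def stepSize (f : M → Ω → ℝ) (α β ε : ℝ) (w : ℕ → Ω) (x : ℕ → M) (t : ℕ) : ℝ :=
  α / (β + ∑ s ∈ Finset.range t, ‖mgrad m (fun y => f y (w s)) (x s)‖ ^ 2) ^ (1 / 2 + ε)

/-- The iterates of adaptive stochastic gradient descent started at `x₀` along the sequence `w` of
samples (see `sgd_zero` and `sgd_succ` for the recursion). -/
def sgd (R : TangentBundle (𝓡 m) M → M) (f : M → Ω → ℝ) (α β ε : ℝ) (x₀ : M) (w : ℕ → Ω) :
    ℕ → M
  | 0 => x₀
  | t + 1 =>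
    retrAt R (sgd R f α β ε x₀ w t)
      (-((α / (β + ∑ s : Fin t,
            ‖mgrad m (fun y => f y (w s)) (sgd R f α β ε x₀ w s)‖ ^ 2) ^ (1 / 2 + ε)) •
        mgrad m (fun y => f y (w t)) (sgd R f α β ε x₀ w t)))
  termination_by t => t
  decreasing_by all_goals omega

theorem sgd_zero (R : TangentBundle (𝓡 m) M → M) (f : M → Ω → ℝ) (α β ε : ℝ) (x₀ : M)
    (w : ℕ → Ω) : sgd R f α β ε x₀ w 0 = x₀ := by
  rw [sgd]

/-- `x_{t+1} = R_{x_t}(-η_t ∇_M f(x_t, ω_t))`. -/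
theorem sgd_succ (R : TangentBundle (𝓡 m) M → M) (f : M → Ω → ℝ) (α β ε : ℝ) (x₀ : M)
    (w : ℕ → Ω) (t : ℕ) :
    sgd R f α β ε x₀ w (t + 1) =
      retrAt R (sgd R f α β ε x₀ w t)
        (-(stepSize m f α β ε w (sgd R f α β ε x₀ w) t •
          mgrad m (fun y => f y (w t)) (sgd R f α β ε x₀ w t))) := by
  rw [sgd, stepSize, Finset.sum_range]

end AdaSGD

end

/-!
The proof is a descent argument for `F` along the iterates, with one twist that replaces the usual
Lipschitz estimate for `‖∇F‖²`.

When `ρ₀ ≤ ρ x ≤ ρ₁`, the second confinement inequality bounds the second derivative of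
`s ↦ ρ (R_x (-s ∇f(x, ω)))` on `[0, κ]` by `2 / κ` times its rate of decrease at `0`, so this
function does not exceed `ρ x`. The first inequality covers the case `ρ x ≤ ρ₀`. Hence no iterate
leaves the compact set `K₁` (`IsConfinementWith.sgd_le`).

The Lipschitz condition on the pulled back gradients bounds the first-order Taylor remainder of
`f(·, ω) ∘ R_x` by a multiple of `‖v‖²`, uniformly in `ω`. Integrating shows that `F ∘ R_x` is
differentiable at `0`; since `R_x` is a local diffeomorphism at `0`, `F` is differentiable and
`∇F = ∫ ∇f dμ` (`IsRegularIntegrand.mdifferentiable_integral`,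
`IsRegularIntegrand.inner_mgrad_integral`). The same condition makes `∇f(·, ω)` and `∇F` continuous
sections of `TM` (`IsRetraction.continuousAt_mgrad`). Hence all the maps in play are continuous in
the point and measurable in the sample, so jointly measurable, and the iterates are adapted to the
samples (`IsRegularIntegrand.measurable_sgd`).

The step size `η_t` depends only on the samples before time `t`. Independence therefore gives
`E[η_t ⟨∇F(x_t), ∇f(x_t, ω_t)⟩] = E[η_t ‖∇F(x_t)‖²]`, and summing the descent inequality bounds
`E ∑ η_t ‖∇F(x_t)‖²` by a constant plus a multiple of `E ∑ η_t² ‖∇f(x_t, ω_t)‖²`. The latter sum is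
bounded along every trajectory, as `∑ q_t / (β + q_0 + ⋯ + q_{t-1})^{1 + 2ε}` converges for every
bounded sequence `q_t ≥ 0` (`sum_div_rpow_le`). So `∑ η_t ‖∇F(x_t)‖² < ∞` almost surely
(`IsRegularIntegrand.ae_summable_mul_sq`), while `∑ η_t = ∞` because `1/2 + ε ≤ 1`
(`not_summable_div_rpow`).

It remains to exclude that `‖∇F(x_t)‖` oscillates. It is small at infinitely many times. If it also
exceeded `2δ` infinitely often, a smooth function `φ : M → [0, 1]` equal to `0` where `‖∇F‖ ≤ δ` and
to `1` where `‖∇F‖ ≥ 2δ` would vary by `1` on each crossing. As `φ ∘ R_x` is Lipschitz at `0`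
uniformly for `x ∈ K₁`, a crossing uses up a fixed amount of `∑ η_t` while `‖∇F(x_t)‖ ≥ δ`, which
contradicts the summability (`tendsto_zero_of_summable_mul_sq`,
`IsRetraction.tendsto_zero_of_summable`).
-/

namespace AdaSGD

/-! ### Local sections of maps into a manifold, and the inclusion of a tangent space in `TM` -/

/-- A `C^1` map from a Banach space to `M` whose differential at `0` is invertible, read in the
chart at `ψ 0 = x`, has a right inverse near `x` that is differentiable at `x`. -/
theorem exists_local_section {m : ℕ} {M : Type*} [TopologicalSpace M]
    [ChartedSpace (EuclideanSpace ℝ (Fin m)) M] [IsManifold (𝓡 m) ∞ M]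
    {V : Type*} [NormedAddCommGroup V] [NormedSpace ℝ V] [CompleteSpace V]
    {ψ : V → M} {x : M} (hψ : ContMDiffAt 𝓘(ℝ, V) (𝓡 m) 1 ψ 0) (h0 : ψ 0 = x)
    (hinv : (fderiv ℝ (fun v => extChartAt (𝓡 m) x (ψ v)) 0).IsInvertible) :
    ∃ θ : M → V, MDifferentiableAt (𝓡 m) 𝓘(ℝ, V) θ x ∧ θ x = 0 ∧ ∀ᶠ y in 𝓝 x, ψ (θ y) = y := by
  have hr : ContDiffAt ℝ 1 (fun v => extChartAt (𝓡 m) x (ψ v)) 0 := by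
    rw [← contMDiffAt_iff_contDiffAt]
    refine ContMDiffAt.comp (I' := 𝓡 m) 0 ?_ hψ
    rw [h0]
    exact contMDiffAt_extChartAt
  obtain ⟨A, hA⟩ := hinv
  have hs : HasStrictFDerivAt (fun v => extChartAt (𝓡 m) x (ψ v))
      (A : V →L[ℝ] EuclideanSpace ℝ (Fin m)) 0 := by
    rw [hA]
    exact hr.hasStrictFDerivAt one_ne_zero
  have hx0 : extChartAt (𝓡 m) x (ψ 0) = extChartAt (𝓡 m) x x := by rw [h0]
  refine ⟨fun y => hs.localInverse _ _ _ (extChartAt (𝓡 m) x y), ?_, ?_, ?_⟩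
  · have h1 : DifferentiableAt ℝ (hs.localInverse _ _ _) (extChartAt (𝓡 m) x x) := by
      have := hs.to_localInverse.hasFDerivAt.differentiableAt
      rwa [hx0] at this
    exact MDifferentiableAt.comp (I' := 𝓘(ℝ, EuclideanSpace ℝ (Fin m))) x
      h1.mdifferentiableAt (mdifferentiableAt_extChartAt (mem_chart_source _ x))
  · have := hs.localInverse_apply_image
    simp only [hx0] at this
    exact this
  · have hc : ContinuousAt (extChartAt (𝓡 m) x) x := continuousAt_extChartAt x
    have h2 := hs.eventually_right_inverse
    have h3 : ∀ᶠ p in 𝓝 (extChartAt (𝓡 m) x x),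
        ψ (hs.localInverse _ _ _ p) ∈ (extChartAt (𝓡 m) x).source := by
      have c1 : ContinuousAt (hs.localInverse _ _ _) (extChartAt (𝓡 m) x x) := by
        have := hs.localInverse_continuousAt
        rwa [hx0] at this
      have e1 : hs.localInverse _ _ _ (extChartAt (𝓡 m) x x) = 0 := by
        have := hs.localInverse_apply_image
        simp only [hx0] at this
        exact this
      have c2 : ContinuousAt ψ (hs.localInverse _ _ _ (extChartAt (𝓡 m) x x)) := by
        rw [e1]; exact hψ.continuousAt
      have c3 := c2.comp c1
      refine c3.eventually_mem ?_
      simp only [Function.comp_apply, e1, h0]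
      exact extChartAt_source_mem_nhds x
    simp only [hx0] at h2
    filter_upwards [hc.eventually h2, hc.eventually h3, extChartAt_source_mem_nhds (I := 𝓡 m) x]
      with y h4 h5 h6
    exact (extChartAt (𝓡 m) x).injOn h5 h6 h4

theorem contMDiff_tangent_mk {m : ℕ} {M : Type*} [TopologicalSpace M]
    [ChartedSpace (EuclideanSpace ℝ (Fin m)) M] [IsManifold (𝓡 m) ∞ M]
    [RiemannianBundle (fun x : M => TangentSpace (𝓡 m) x)] {n : WithTop ℕ∞} (x : M) :
    ContMDiff 𝓘(ℝ, TangentSpace (𝓡 m) x) (𝓡 m).tangent n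
      (fun v => (⟨x, v⟩ : TangentBundle (𝓡 m) M)) := by
  intro v
  rw [contMDiffAt_totalSpace]
  refine ⟨contMDiffAt_const, ?_⟩
  have h : (fun v : TangentSpace (𝓡 m) x =>
      (trivializationAt (EuclideanSpace ℝ (Fin m)) (TangentSpace (𝓡 m)) x ⟨x, v⟩).2) =
      (trivializationAt (EuclideanSpace ℝ (Fin m)) (TangentSpace (𝓡 m)) x).continuousLinearMapAt
        ℝ x := by
    ext1 v
    rw [Trivialization.continuousLinearMapAt_apply, Trivialization.linearMapAt_apply]
    simp
  have h2 := ((trivializationAt (EuclideanSpace ℝ (Fin m))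
    (TangentSpace (𝓡 m)) x).continuousLinearMapAt ℝ x).contDiff (n := n)
  rw [contMDiffAt_iff_contDiffAt]
  rw [← h] at h2
  exact h2.contDiffAt

/-! ### Retractions and continuity of Riemannian gradients -/

/-- If the linear functionals `⟨u_y, ·⟩_y`, transported to the model fiber by a trivialization,
depend continuously on `y`, then the section `u` is continuous. The section is compared with the
one that is constant in the trivialization. -/
theorem continuousAt_section_of_inner {B : Type*} [TopologicalSpace B] {F : Type*}
    [NormedAddCommGroup F] [NormedSpace ℝ F] [FiniteDimensional ℝ F] {E : B → Type*}
    [TopologicalSpace (TotalSpace F E)] [∀ x, NormedAddCommGroup (E x)]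
    [∀ x, InnerProductSpace ℝ (E x)] [FiberBundle F E] [VectorBundle ℝ F E]
    [IsContinuousRiemannianBundle F E] {u : ∀ y, E y} {l : B → F →L[ℝ] ℝ} {x : B}
    (hl : ContinuousAt l x)
    (hu : ∀ᶠ y in 𝓝 x, ∀ v : E y,
      inner ℝ (u y) v = l y ((trivializationAt F E x).continuousLinearMapAt ℝ y v)) :
    ContinuousAt (fun y => (⟨y, u y⟩ : TotalSpace F E)) x := by
  set T := trivializationAt F E x with hT
  have hx : x ∈ T.baseSet := FiberBundle.mem_baseSet_trivializationAt' x
  have hbase : ∀ᶠ y in 𝓝 x, y ∈ T.baseSet := T.open_baseSet.mem_nhds hx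
  have hconst : ∀ w : F, ContinuousAt (fun y => (⟨y, T.symmL ℝ y w⟩ : TotalSpace F E)) x := by
    intro w
    rw [FiberBundle.continuousAt_totalSpace]
    refine ⟨continuousAt_id, ?_⟩
    refine (continuousAt_const (y := w)).congr ?_
    filter_upwards [hbase] with y hy
    have := T.continuousLinearMapAt_symmL (R := ℝ) hy w
    rw [T.continuousLinearMapAt_apply_of_mem ℝ hy] at this
    exact this.symm
  set w₀ : F := T.continuousLinearMapAt ℝ x (u x) with hw₀
  -- `V` extends the vector `u x` to a section that is constant in the trivialization; `D y`
  -- measures how far the functional `⟨V y, ·⟩` is from `⟨u y, ·⟩ = l y`, and `D x = 0`.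
  set V : ∀ y, E y := fun y => T.symmL ℝ y w₀ with hV
  have hVx : V x = u x := T.symmL_continuousLinearMapAt hx (u x)
  set D : B → F →L[ℝ] ℝ := fun y => l y - (innerSL ℝ (V y)) ∘L T.symmL ℝ y with hD
  have hDx : D x = 0 := by
    ext w
    simp only [hD, _root_.sub_apply, ContinuousLinearMap.comp_apply, innerSL_apply_apply,
      hVx, _root_.zero_apply]
    rw [hu.self_of_nhds, T.continuousLinearMapAt_symmL hx, sub_self]
  have hDc : ContinuousAt D x := by
    rw [continuousAt_clm_apply]
    intro w
    have h1 : ContinuousAt (fun y => inner ℝ (V y) (T.symmL ℝ y w)) x :=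
      ContinuousAt.inner_bundle (hconst w₀) (hconst w)
    exact (hl.clm_apply continuousAt_const).sub h1
  obtain ⟨C, hC, hCe⟩ := eventually_norm_trivializationAt_lt F E x
  have hkey : ∀ᶠ y in 𝓝 x, ‖T.continuousLinearMapAt ℝ y (u y) - w₀‖ ≤ C * (‖D y‖ * C) := by
    filter_upwards [hCe, hu, hbase] with y h1 h2 h3
    have h4 : ‖u y - V y‖ ≤ ‖D y‖ * C := by
      have h5 : inner ℝ (u y - V y) (u y - V y) =
          D y (T.continuousLinearMapAt ℝ y (u y - V y)) := by
        rw [inner_sub_left, h2]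
        simp only [hD, _root_.sub_apply, ContinuousLinearMap.comp_apply,
          innerSL_apply_apply]
        rw [T.symmL_continuousLinearMapAt h3]
      have h6 : D y (T.continuousLinearMapAt ℝ y (u y - V y)) ≤ ‖D y‖ * (C * ‖u y - V y‖) :=
        (le_abs_self _).trans ((D y).le_opNorm_of_le
          ((T.continuousLinearMapAt ℝ y).le_of_opNorm_le h1.le _))
      rw [← h5, real_inner_self_eq_norm_sq, sq, ← mul_assoc] at h6
      by_contra! h7
      have : 0 < ‖u y - V y‖ := lt_of_le_of_lt (by positivity) h7
      exact absurd (le_of_mul_le_mul_right h6 this) (not_le.2 h7)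
    have h8 : T.continuousLinearMapAt ℝ y (u y) - w₀ =
        T.continuousLinearMapAt ℝ y (u y - V y) := by
      rw [map_sub]
      simp only [hV]
      rw [T.continuousLinearMapAt_symmL h3]
    rw [h8]
    exact ((T.continuousLinearMapAt ℝ y).le_of_opNorm_le h1.le _).trans
      (mul_le_mul_of_nonneg_left h4 hC.le)
  rw [FiberBundle.continuousAt_totalSpace]
  refine ⟨continuousAt_id, ?_⟩
  have hlim : Tendsto (fun y => T.continuousLinearMapAt ℝ y (u y)) (𝓝 x) (𝓝 w₀) := by
    rw [tendsto_iff_norm_sub_tendsto_zero]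
    refine squeeze_zero' (Eventually.of_forall fun _ => norm_nonneg _) hkey ?_
    have : Tendsto (fun y => C * (‖D y‖ * C)) (𝓝 x) (𝓝 (C * (‖D x‖ * C))) :=
      ((hDc.norm.mul continuousAt_const).const_mul C)
    simpa [hDx] using this
  have hlim2 := hlim.congr' (f₂ := fun y => (T ⟨y, u y⟩).2) (by
    filter_upwards [hbase] with y hy
    rw [T.continuousLinearMapAt_apply_of_mem ℝ hy])
  have : (T ⟨x, u x⟩).2 = w₀ := by rw [hw₀, T.continuousLinearMapAt_apply_of_mem ℝ hx]
  rw [ContinuousAt]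
  simp only
  rw [this]
  exact hlim2

section Retraction

variable {m : ℕ} {M : Type*} [TopologicalSpace M] [ChartedSpace (EuclideanSpace ℝ (Fin m)) M]
  [RiemannianBundle (fun x : M => TangentSpace (𝓡 m) x)]

theorem inner_mgrad (h : M → ℝ) (x : M) (v : TangentSpace (𝓡 m) x) :
    inner ℝ (mgrad m h x) v = mfderiv (𝓡 m) 𝓘(ℝ, ℝ) h x v := by
  exact InnerProductSpace.toDual_symm_apply

variable [IsManifold (𝓡 m) ∞ M] {R : TangentBundle (𝓡 m) M → M}

theorem norm_gradient_sub {V : Type*} [NormedAddCommGroup V] [InnerProductSpace ℝ V]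
    [CompleteSpace V] (h : V → ℝ) (u v : V) :
    ‖gradient h u - gradient h v‖ = ‖fderiv ℝ h u - fderiv ℝ h v‖ := by
  rw [gradient, gradient, ← map_sub, LinearIsometryEquiv.norm_map]

theorem IsRetraction.contMDiff_retrAt {n : WithTop ℕ∞} (hR : IsRetraction n R) (x : M) :
    ContMDiff 𝓘(ℝ, TangentSpace (𝓡 m) x) (𝓡 m) n (retrAt R x) :=
  hR.contMDiff.comp (contMDiff_tangent_mk x)

theorem IsRetraction.mdifferentiableAt_retrAt (hR : IsRetraction 2 R) (x : M)
    (v : TangentSpace (𝓡 m) x) :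
    MDifferentiableAt 𝓘(ℝ, TangentSpace (𝓡 m) x) (𝓡 m) (retrAt R x) v :=
  (hR.contMDiff_retrAt x).mdifferentiableAt two_ne_zero

theorem IsRetraction.differentiableAt_comp {V : Type*} [NormedAddCommGroup V] [NormedSpace ℝ V]
    (hR : IsRetraction 2 R) {g : M → V}
    {x : M} {v : TangentSpace (𝓡 m) x}
    (hg : MDifferentiableAt (𝓡 m) 𝓘(ℝ, V) g (retrAt R x v)) :
    DifferentiableAt ℝ (fun u => g (retrAt R x u)) v := by
  rw [← mdifferentiableAt_iff_differentiableAt]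
  exact MDifferentiableAt.comp v hg (hR.mdifferentiableAt_retrAt x v)

theorem IsRetraction.fderiv_comp {V : Type*} [NormedAddCommGroup V] [NormedSpace ℝ V]
    (hR : IsRetraction 2 R) {g : M → V}
    {x : M} {v : TangentSpace (𝓡 m) x}
    (hg : MDifferentiableAt (𝓡 m) 𝓘(ℝ, V) g (retrAt R x v)) (u : TangentSpace (𝓡 m) x) :
    fderiv ℝ (fun u => g (retrAt R x u)) v u =
      mfderiv (𝓡 m) 𝓘(ℝ, V) g (retrAt R x v)
        (mfderiv 𝓘(ℝ, TangentSpace (𝓡 m) x) (𝓡 m) (retrAt R x) v u) := by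
  rw [← mfderiv_eq_fderiv]
  have := mfderiv_comp v hg (hR.mdifferentiableAt_retrAt x v)
  exact DFunLike.congr_fun this u

theorem IsRetraction.fderiv_comp_zero {V : Type*} [NormedAddCommGroup V] [NormedSpace ℝ V]
    (hR : IsRetraction 2 R) {g : M → V}
    {x : M} (hg : MDifferentiableAt (𝓡 m) 𝓘(ℝ, V) g x) (u : TangentSpace (𝓡 m) x) :
    fderiv ℝ (fun u => g (retrAt R x u)) 0 u = mfderiv (𝓡 m) 𝓘(ℝ, V) g x u := by
  have h0 : retrAt R x 0 = x := hR.apply_zero x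
  have hg' : MDifferentiableAt (𝓡 m) 𝓘(ℝ, V) g (retrAt R x 0) := by rwa [h0]
  rw [hR.fderiv_comp hg' u]
  have h1 : ∀ p q : TangentBundle (𝓡 m) M, p = q →
      (mfderiv (𝓡 m) 𝓘(ℝ, V) g p.1 p.2 : V) = mfderiv (𝓡 m) 𝓘(ℝ, V) g q.1 q.2 := by
    rintro p q rfl
    rfl
  exact h1 _ _ (hR.mfderiv_zero x u)

theorem IsRetraction.contDiffAt_extChartAt_comp (hR : IsRetraction 2 R) (x : M) :
    ContDiffAt ℝ 2 (fun v => extChartAt (𝓡 m) x (retrAt R x v)) 0 := by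
  rw [← contMDiffAt_iff_contDiffAt]
  refine ContMDiffAt.comp (I' := 𝓡 m) 0 ?_ (hR.contMDiff_retrAt x).contMDiffAt
  rw [hR.apply_zero x]
  exact contMDiffAt_extChartAt

theorem IsRetraction.isInvertible_fderiv (hR : IsRetraction 2 R) (x : M) :
    (fderiv ℝ (fun v => extChartAt (𝓡 m) x (retrAt R x v)) 0).IsInvertible := by
  have h := isInvertible_mfderiv_extChartAt (I := 𝓡 m) (mem_extChartAt_source (I := 𝓡 m) x)
  have h2 : fderiv ℝ (fun v => extChartAt (𝓡 m) x (retrAt R x v)) 0 =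
      mfderiv (𝓡 m) 𝓘(ℝ, EuclideanSpace ℝ (Fin m)) (extChartAt (𝓡 m) x) x := by
    ext1 u
    exact hR.fderiv_comp_zero (mdifferentiableAt_extChartAt (mem_chart_source _ x)) u
  rw [h2]
  exact h

/-- By the inverse function theorem `R_x` has a local right inverse `θ` near `x`. -/
theorem IsRetraction.exists_section (hR : IsRetraction 2 R) (x : M) :
    ∃ θ : M → TangentSpace (𝓡 m) x,
      MDifferentiableAt (𝓡 m) 𝓘(ℝ, TangentSpace (𝓡 m) x) θ x ∧ θ x = 0 ∧
        ∀ᶠ y in 𝓝 x, retrAt R x (θ y) = y :=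
  exists_local_section ((hR.contMDiff_retrAt x).of_le one_le_two).contMDiffAt (hR.apply_zero x)
    (hR.isInvertible_fderiv x)

/-- `g` is differentiable at `x` as soon as `g ∘ R_x` is differentiable at `0_x`. -/
theorem IsRetraction.mdifferentiableAt_of_comp (hR : IsRetraction 2 R) {g : M → ℝ} {x : M}
    (hg : DifferentiableAt ℝ (fun u => g (retrAt R x u)) (0 : TangentSpace (𝓡 m) x)) :
    MDifferentiableAt (𝓡 m) 𝓘(ℝ, ℝ) g x := by
  obtain ⟨θ, hθ, hθ0, hθe⟩ := hR.exists_section x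
  rw [← hθ0] at hg
  have h := MDifferentiableAt.comp (I' := 𝓘(ℝ, TangentSpace (𝓡 m) x)) x
    hg.mdifferentiableAt hθ
  refine h.congr_of_eventuallyEq ?_
  filter_upwards [hθe] with y hy
  simp [hy]

theorem IsRetraction.fderiv_comp_zero_apply (hR : IsRetraction 2 R) {g : M → ℝ}
    {x : M} (hg : MDifferentiableAt (𝓡 m) 𝓘(ℝ, ℝ) g x) (u : TangentSpace (𝓡 m) x) :
    fderiv ℝ (fun u => g (retrAt R x u)) 0 u = inner ℝ (mgrad m g x) u := by
  rw [inner_mgrad]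
  exact hR.fderiv_comp_zero hg u

theorem isContinuousRiemannianBundle_tangentSpace
    [IsContMDiffRiemannianBundle (𝓡 m) ∞ (EuclideanSpace ℝ (Fin m))
      (fun x : M => TangentSpace (𝓡 m) x)] :
    IsContinuousRiemannianBundle (EuclideanSpace ℝ (Fin m))
      (fun x : M => TangentSpace (𝓡 m) x) := by
  obtain ⟨g, hg, hg'⟩ := IsContMDiffRiemannianBundle.exists_contMDiff (IB := 𝓡 m) (n := ∞)
    (F := EuclideanSpace ℝ (Fin m)) (E := fun x : M => TangentSpace (𝓡 m) x)
  exact ⟨g, hg.continuous, hg'⟩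

/-- If the derivative of `g ∘ R_x` is continuous at `0_x`, then the gradient of `g` is a section of
`TM` that is continuous at `x`: near `x`, the differential of `g` in the chart at `x` is recovered
from that of `g ∘ R_x` by composing with the inverse of the differential of `R_x`. -/
theorem IsRetraction.continuousAt_mgrad
    [IsContMDiffRiemannianBundle (𝓡 m) ∞ (EuclideanSpace ℝ (Fin m))
      (fun x : M => TangentSpace (𝓡 m) x)] (hR : IsRetraction 2 R) {g : M → ℝ} {x : M}
    (hg : MDifferentiable (𝓡 m) 𝓘(ℝ, ℝ) g)
    (hc : ContinuousAt (fderiv ℝ (fun u => g (retrAt R x u))) (0 : TangentSpace (𝓡 m) x)) :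
    ContinuousAt (fun y => (⟨y, mgrad m g y⟩ : TangentBundle (𝓡 m) M)) x := by
  have := isContinuousRiemannianBundle_tangentSpace (m := m) (M := M)
  obtain ⟨θ, hθ, hθ0, hθe⟩ := hR.exists_section x
  have hθc : ContinuousAt θ x := hθ.continuousAt
  set e := extChartAt (𝓡 m) x with he
  set r : TangentSpace (𝓡 m) x → EuclideanSpace ℝ (Fin m) := fun v => e (retrAt R x v) with hr
  set G : EuclideanSpace ℝ (Fin m) → ℝ := fun p => g (e.symm p) with hG
  have hsrc : ∀ᶠ y in 𝓝 x, y ∈ e.source := extChartAt_source_mem_nhds x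
  have hGd : ∀ y ∈ e.source, DifferentiableAt ℝ G (e y) := by
    intro y hy
    rw [← mdifferentiableAt_iff_differentiableAt]
    have h1 : MDifferentiableAt 𝓘(ℝ, EuclideanSpace ℝ (Fin m)) (𝓡 m) e.symm (e y) := by
      have h2 := mdifferentiableWithinAt_extChartAt_symm (I := 𝓡 m) (x := x) (e.map_source hy)
      rwa [ModelWithCorners.range_eq_univ, mdifferentiableWithinAt_univ] at h2
    exact MDifferentiableAt.comp (I' := 𝓡 m) (e y) (hg _) h1
  have hinv := hR.isInvertible_fderiv x
  have hrc2 : ContDiffAt ℝ 2 r 0 := hR.contDiffAt_extChartAt_comp x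
  have hrc : ContinuousAt (fderiv ℝ r) 0 :=
    (hrc2.fderiv_right (m := 1) (by norm_num)).continuousAt
  have hrd : ∀ᶠ v in 𝓝 (0 : TangentSpace (𝓡 m) x), DifferentiableAt ℝ r v := by
    filter_upwards [hrc2.eventually (by simp)] with v hv
    exact hv.differentiableAt (by simp)
  have hthx : Tendsto θ (𝓝 x) (𝓝 0) := by simpa [hθ0] using hθc.tendsto
  have hinvev : ∀ᶠ y in 𝓝 x, (fderiv ℝ r (θ y)).IsInvertible := by
    obtain ⟨A, hA⟩ := hinv
    have h1 : ∀ᶠ L in 𝓝 (fderiv ℝ r 0), L.IsInvertible := by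
      have := ContinuousLinearEquiv.nhds A
      rw [hA] at this
      filter_upwards [this] with L hL
      exact hL
    exact (hrc.tendsto.comp hthx).eventually h1
  have hGe : ∀ᶠ y in 𝓝 x, fderiv ℝ (fun u => g (retrAt R x u)) (θ y) ∘L
      (fderiv ℝ r (θ y)).inverse = fderiv ℝ G (e y) := by
    filter_upwards [hinvev, hsrc, hθe, hthx.eventually hrd, hthx.eventually
      (eventually_eventually_nhds.2 ((hR.contMDiff_retrAt x).continuous.continuousAt.eventually
        (by rw [hR.apply_zero]; exact hsrc)))] with y h1 h2 h3 h4 h5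
    have h6 : (fun u => g (retrAt R x u)) =ᶠ[𝓝 (θ y)] fun u => G (r u) := by
      filter_upwards [h5] with u hu
      simp only [hG, hr]
      rw [e.left_inv hu]
    have h7 : r (θ y) = e y := by simp only [hr, h3]
    have h8 : fderiv ℝ (fun u => g (retrAt R x u)) (θ y) =
        fderiv ℝ G (e y) ∘L fderiv ℝ r (θ y) := by
      rw [h6.fderiv_eq]
      have h9 : DifferentiableAt ℝ G (r (θ y)) := by rw [h7]; exact hGd y h2
      have := _root_.fderiv_comp (θ y) h9 h4
      rw [h7] at this
      exact this
    rw [h8, ContinuousLinearMap.comp_assoc, h1.self_comp_inverse, ContinuousLinearMap.comp_id]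
  have hGcont : ContinuousAt (fun y => fderiv ℝ G (e y)) x := by
    refine ContinuousAt.congr ?_ hGe
    have c1 : ContinuousAt (fun y => fderiv ℝ (fun u => g (retrAt R x u)) (θ y)) x :=
      ContinuousAt.comp_of_eq hc hθc hθ0
    have c2 : ContinuousAt (fun y => (fderiv ℝ r (θ y)).inverse) x := by
      have c3 : ContinuousAt (fun y => fderiv ℝ r (θ y)) x :=
        ContinuousAt.comp_of_eq hrc hθc hθ0
      refine ContinuousAt.comp_of_eq (g := ContinuousLinearMap.inverse)
        (hinv.contDiffAt_map_inverse (n := 0)).continuousAt c3 ?_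
      rw [hθ0]
    exact c1.clm_comp c2
  refine continuousAt_section_of_inner hGcont ?_
  filter_upwards [hsrc] with y hy v
  rw [inner_mgrad]
  have hyc : y ∈ (chartAt (EuclideanSpace ℝ (Fin m)) x).source := by
    rwa [he, extChartAt_source] at hy
  rw [TangentBundle.continuousLinearMapAt_trivializationAt hyc]
  have h1 : g =ᶠ[𝓝 y] G ∘ e := by
    filter_upwards [extChartAt_source_mem_nhds' (I := 𝓡 m) hy] with z hz
    simp only [hG, Function.comp]
    rw [e.left_inv hz]
  rw [h1.mfderiv_eq]
  have h2 := mfderiv_comp y (hGd y hy).mdifferentiableAt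
    (mdifferentiableAt_extChartAt (I := 𝓡 m) hyc)
  rw [mfderiv_eq_fderiv] at h2
  exact DFunLike.congr_fun h2 v

end Retraction

/-! ### Expectations of random functions -/

/-- First-order Taylor estimate for a function whose derivative is Lipschitz relative to `0`. -/
theorem abs_sub_fderiv_zero_le {V : Type*} [NormedAddCommGroup V] [NormedSpace ℝ V] {h : V → ℝ}
    (hd : Differentiable ℝ h) {C r : ℝ}
    (hC : ∀ u, ‖u‖ ≤ r → ‖fderiv ℝ h u - fderiv ℝ h 0‖ ≤ C * ‖u‖) (hC0 : 0 ≤ C) {v : V}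
    (hv : ‖v‖ ≤ r) : |h v - h 0 - fderiv ℝ h 0 v| ≤ C * ‖v‖ ^ 2 := by
  have h1 : ∀ u ∈ Metric.closedBall (0 : V) ‖v‖,
      HasFDerivWithinAt (fun u => h u - fderiv ℝ h 0 u) (fderiv ℝ h u - fderiv ℝ h 0)
        (Metric.closedBall (0 : V) ‖v‖) u := fun u _ =>
    ((hd u).hasFDerivAt.sub (fderiv ℝ h 0).hasFDerivAt).hasFDerivWithinAt
  have h2 := (convex_closedBall (0 : V) ‖v‖).norm_image_sub_le_of_norm_hasFDerivWithin_le h1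
    (C := C * ‖v‖) (fun u hu => by
      rw [mem_closedBall_zero_iff] at hu
      exact (hC u (hu.trans hv)).trans (mul_le_mul_of_nonneg_left hu hC0))
    (Metric.mem_closedBall_self (norm_nonneg v)) (y := v) (by simp)
  rw [Real.norm_eq_abs] at h2
  simp only [map_zero, sub_zero] at h2
  calc |h v - h 0 - fderiv ℝ h 0 v| = |h v - fderiv ℝ h 0 v - h 0| := by ring_nf
    _ ≤ C * ‖v‖ ^ 2 := by rw [sq, ← mul_assoc]; exact h2

theorem continuousAt_fderiv_of_le {V : Type*} [NormedAddCommGroup V] [NormedSpace ℝ V] {h : V → ℝ}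
    {C r : ℝ} (hr : 0 < r) (hC : ∀ u, ‖u‖ ≤ r → ‖fderiv ℝ h u - fderiv ℝ h 0‖ ≤ C * ‖u‖) :
    ContinuousAt (fderiv ℝ h) 0 := by
  rw [ContinuousAt, tendsto_iff_norm_sub_tendsto_zero]
  refine squeeze_zero' (g := fun u => C * ‖u‖) (Eventually.of_forall fun _ => norm_nonneg _) ?_ ?_
  · filter_upwards [Metric.closedBall_mem_nhds (0 : V) hr] with u hu
    exact hC u (mem_closedBall_zero_iff.1 hu)
  · have : Tendsto (fun u : V => C * ‖u‖) (𝓝 0) (𝓝 (C * ‖(0 : V)‖)) :=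
      (continuous_const.mul continuous_norm).tendsto 0
    simpa using this

section Expectation

variable {m : ℕ} {M : Type*} [TopologicalSpace M] [ChartedSpace (EuclideanSpace ℝ (Fin m)) M]
  [RiemannianBundle (fun x : M => TangentSpace (𝓡 m) x)]
  {R : TangentBundle (𝓡 m) M → M} {Ω : Type*} {f : M → Ω → ℝ}

theorem LocallyRLipschitzGradient.exists_fderiv_le (hf : LocallyRLipschitzGradient R f)
    {K : Set M} (hK : IsCompact K) {r : ℝ} (hr : 0 < r) :
    ∃ C : ℝ, 0 < C ∧ ∀ x ∈ K, ∀ v : TangentSpace (𝓡 m) x, ‖v‖ ≤ r → ∀ a : Ω,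
      ‖fderiv ℝ (fun u => f (retrAt R x u) a) v - fderiv ℝ (fun u => f (retrAt R x u) a) 0‖
        ≤ C * ‖v‖ := by
  obtain ⟨C, hC, h⟩ := hf K hK r hr
  refine ⟨C, hC, fun x hx v hv a => ?_⟩
  rw [← norm_gradient_sub]
  exact h x hx v hv a

/-- The standing assumptions on a random function `f` on `M`: it is measurable in the sample,
differentiable on `M`, locally bounded together with its gradient, and its gradient is locally
`R`-Lipschitz. -/
structure IsRegularIntegrand [MeasurableSpace Ω] (R : TangentBundle (𝓡 m) M → M)
    (f : M → Ω → ℝ) : Prop where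
  measurable : ∀ x, Measurable (f x)
  diff : DifferentiableInM m f
  bdd : LocallyBounded f
  grad_bdd : LocallyBounded (fun (x : M) (a : Ω) => ‖mgrad m (fun y => f y a) x‖)
  lip : LocallyRLipschitzGradient R f

theorem IsRegularIntegrand.integrable [MeasurableSpace Ω] (hf : IsRegularIntegrand R f)
    (μ : Measure Ω) [IsFiniteMeasure μ] (x : M) : Integrable (f x) μ := by
  obtain ⟨C, -, hC⟩ := hf.bdd {x} isCompact_singleton
  exact Integrable.of_bound (hf.measurable x).aestronglyMeasurable C
    (Eventually.of_forall fun a => hC x rfl a)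

variable [IsManifold (𝓡 m) ∞ M]

theorem IsRetraction.differentiable_comp (hR : IsRetraction 2 R) {g : M → ℝ}
    (hg : MDifferentiable (𝓡 m) 𝓘(ℝ, ℝ) g) (x : M) :
    Differentiable ℝ (fun u => g (retrAt R x u)) := fun _ => hR.differentiableAt_comp (hg _)

theorem IsRetraction.abs_sub_inner_mgrad_le (hR : IsRetraction 2 R) {g : M → ℝ} {x : M}
    (hg : MDifferentiable (𝓡 m) 𝓘(ℝ, ℝ) g) {C r : ℝ} (hC0 : 0 ≤ C)
    (hC : ∀ u : TangentSpace (𝓡 m) x, ‖u‖ ≤ r →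
      ‖fderiv ℝ (fun u => g (retrAt R x u)) u - fderiv ℝ (fun u => g (retrAt R x u)) 0‖
        ≤ C * ‖u‖) {v : TangentSpace (𝓡 m) x} (hv : ‖v‖ ≤ r) :
    |g (retrAt R x v) - g x - inner ℝ (mgrad m g x) v| ≤ C * ‖v‖ ^ 2 := by
  have h1 := abs_sub_fderiv_zero_le (hR.differentiable_comp hg x) hC hC0 hv
  rwa [hR.fderiv_comp_zero_apply (hg x), hR.apply_zero x] at h1

variable [MeasurableSpace Ω]

/-- The directional derivatives of `f` are measurable in the sample, as limits of difference
quotients along `R_x`. -/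
theorem IsRegularIntegrand.measurable_inner (hf : IsRegularIntegrand R f) (hR : IsRetraction 2 R)
    (x : M) (v : TangentSpace (𝓡 m) x) :
    Measurable fun a => inner ℝ (mgrad m (fun y => f y a) x) v := by
  refine measurable_of_tendsto_metrizable (f := fun (n : ℕ) a =>
    (n : ℝ) * (f (retrAt R x ((n : ℝ)⁻¹ • v)) a - f x a))
    (fun n => ((hf.measurable _).sub (hf.measurable _)).const_mul _) ?_
  rw [tendsto_pi_nhds]
  intro a
  have h1 : HasFDerivAt (fun u => f (retrAt R x u) a)
      (fderiv ℝ (fun u => f (retrAt R x u) a) 0) (0 : TangentSpace (𝓡 m) x) :=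
    (hR.differentiable_comp (hf.diff a) x 0).hasFDerivAt
  have h2 := h1.lim v (c := fun n : ℕ => (n : ℝ)) (l := atTop)
    (tendsto_norm_atTop_atTop.comp tendsto_natCast_atTop_atTop)
  rw [hR.fderiv_comp_zero_apply (hf.diff a x)] at h2
  simpa only [smul_eq_mul, zero_add, hR.apply_zero x] using h2

theorem IsRegularIntegrand.integrable_inner (hf : IsRegularIntegrand R f)
    (hR : IsRetraction 2 R) (μ : Measure Ω) [IsFiniteMeasure μ] (x : M)
    (v : TangentSpace (𝓡 m) x) :
    Integrable (fun a => inner ℝ (mgrad m (fun y => f y a) x) v) μ := by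
  obtain ⟨C, hC0, hC⟩ := hf.grad_bdd {x} isCompact_singleton
  refine Integrable.of_bound (hf.measurable_inner hR x v).aestronglyMeasurable (C * ‖v‖)
    (Eventually.of_forall fun a => ?_)
  have h := hC x rfl a
  rw [abs_norm] at h
  exact (norm_inner_le_norm _ _).trans (mul_le_mul_of_nonneg_right h (norm_nonneg _))

variable {μ : Measure Ω} [IsProbabilityMeasure μ]

/-- The expectation of `f ∘ R_x` is differentiable at `0_x`, with the expected differential: the
Taylor remainders are bounded by `C ‖v‖ ^ 2` with the same `C` for all samples. -/
theorem IsRegularIntegrand.hasFDerivAt_integral (hf : IsRegularIntegrand R f)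
    (hR : IsRetraction 2 R) (x : M) :
    ∃ L : TangentSpace (𝓡 m) x →L[ℝ] ℝ,
      (∀ v, L v = ∫ a, inner ℝ (mgrad m (fun y => f y a) x) v ∂μ) ∧
      HasFDerivAt (fun v => ∫ a, f (retrAt R x v) a ∂μ) L (0 : TangentSpace (𝓡 m) x) := by
  obtain ⟨B, hB0, hB⟩ := hf.grad_bdd {x} isCompact_singleton
  let L : TangentSpace (𝓡 m) x →L[ℝ] ℝ := LinearMap.mkContinuous
    { toFun := fun v => ∫ a, inner ℝ (mgrad m (fun y => f y a) x) v ∂μ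
      map_add' := fun v w => by
        simp only [inner_add_right]
        exact integral_add (hf.integrable_inner hR μ x v) (hf.integrable_inner hR μ x w)
      map_smul' := fun c v => by
        simp only [inner_smul_right, RingHom.id_apply, smul_eq_mul]
        exact integral_const_mul _ _ } B (fun v => by
      have h := norm_integral_le_of_norm_le_const (μ := μ)
        (f := fun a => inner ℝ (mgrad m (fun y => f y a) x) v) (C := B * ‖v‖)
        (Eventually.of_forall fun a => by
          have h := hB x rfl a
          rw [abs_norm] at h
          exact (norm_inner_le_norm _ _).trans (mul_le_mul_of_nonneg_right h (norm_nonneg _)))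
      simpa using h)
  have hL : ∀ v, L v = ∫ a, inner ℝ (mgrad m (fun y => f y a) x) v ∂μ := fun v => rfl
  refine ⟨L, hL, ?_⟩
  obtain ⟨C, hC0, hC⟩ := hf.lip.exists_fderiv_le (isCompact_singleton (x := x)) one_pos
  rw [hasFDerivAt_iff_isLittleO_nhds_zero]
  refine Asymptotics.IsBigO.trans_isLittleO (g := fun v : TangentSpace (𝓡 m) x => ‖v‖ ^ 2) ?_
    (Asymptotics.isLittleO_norm_pow_id one_lt_two)
  refine Asymptotics.IsBigO.of_bound C ?_
  filter_upwards [Metric.closedBall_mem_nhds (0 : TangentSpace (𝓡 m) x) one_pos] with v hv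
  rw [mem_closedBall_zero_iff] at hv
  simp only [zero_add, hR.apply_zero x]
  rw [hL, ← integral_sub (hf.integrable μ _) (hf.integrable μ _),
    ← integral_sub (f := fun a => f (retrAt R x v) a - f x a)
      ((hf.integrable μ _).sub (hf.integrable μ _)) (hf.integrable_inner hR μ x v)]
  have h := norm_integral_le_of_norm_le_const (μ := μ)
    (f := fun a => f (retrAt R x v) a - f x a - inner ℝ (mgrad m (fun y => f y a) x) v)
    (C := C * ‖v‖ ^ 2) (Eventually.of_forall fun a =>
      hR.abs_sub_inner_mgrad_le (hf.diff a) hC0.le (fun u hu => hC x rfl u hu a) hv)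
  simpa using h

theorem IsRegularIntegrand.mdifferentiable_integral (hf : IsRegularIntegrand R f)
    (hR : IsRetraction 2 R) :
    MDifferentiable (𝓡 m) 𝓘(ℝ, ℝ) (fun y => ∫ a, f y a ∂μ) := by
  intro x
  obtain ⟨L, -, hL⟩ := hf.hasFDerivAt_integral hR x (μ := μ)
  exact hR.mdifferentiableAt_of_comp hL.differentiableAt

theorem IsRegularIntegrand.inner_mgrad_integral (hf : IsRegularIntegrand R f)
    (hR : IsRetraction 2 R) (x : M) (v : TangentSpace (𝓡 m) x) :
    inner ℝ (mgrad m (fun y => ∫ a, f y a ∂μ) x) v =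
      ∫ a, inner ℝ (mgrad m (fun y => f y a) x) v ∂μ := by
  obtain ⟨L, hL', hL⟩ := hf.hasFDerivAt_integral hR x (μ := μ)
  rw [← hR.fderiv_comp_zero_apply (hf.mdifferentiable_integral hR x), hL.fderiv, hL']

/-- Differentiation of `f ∘ R_x` commutes with the expectation, at every vector `v` of `T_x M`. -/
theorem IsRegularIntegrand.fderiv_integral_apply (hf : IsRegularIntegrand R f)
    (hR : IsRetraction 2 R) (x : M) (v w : TangentSpace (𝓡 m) x) :
    fderiv ℝ (fun u => ∫ a, f (retrAt R x u) a ∂μ) v w =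
      ∫ a, fderiv ℝ (fun u => f (retrAt R x u) a) v w ∂μ := by
  have h1 := hR.fderiv_comp (hf.mdifferentiable_integral hR (μ := μ) (retrAt R x v)) w
  rw [h1, ← inner_mgrad, hf.inner_mgrad_integral hR]
  congr 1
  ext a
  rw [hR.fderiv_comp (hf.diff a _) w, inner_mgrad]

theorem IsRegularIntegrand.norm_fderiv_integral_sub_le (hf : IsRegularIntegrand R f)
    (hR : IsRetraction 2 R) (x : M) (v : TangentSpace (𝓡 m) x) {C : ℝ} (hC0 : 0 ≤ C)
    (hC : ∀ a, ‖fderiv ℝ (fun u => f (retrAt R x u) a) v -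
      fderiv ℝ (fun u => f (retrAt R x u) a) 0‖ ≤ C) :
    ‖fderiv ℝ (fun u => ∫ a, f (retrAt R x u) a ∂μ) v -
      fderiv ℝ (fun u => ∫ a, f (retrAt R x u) a ∂μ) 0‖ ≤ C := by
  have hint : ∀ v w : TangentSpace (𝓡 m) x,
      Integrable (fun a => fderiv ℝ (fun u => f (retrAt R x u) a) v w) μ := by
    intro v w
    refine (hf.integrable_inner hR μ (retrAt R x v)
      (mfderiv 𝓘(ℝ, TangentSpace (𝓡 m) x) (𝓡 m) (retrAt R x) v w)).congr ?_
    filter_upwards with a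
    rw [hR.fderiv_comp (hf.diff a _) w, inner_mgrad]
  refine ContinuousLinearMap.opNorm_le_bound _ hC0 fun w => ?_
  rw [_root_.sub_apply, hf.fderiv_integral_apply hR, hf.fderiv_integral_apply hR,
    ← integral_sub (hint v w) (hint 0 w)]
  have h := norm_integral_le_of_norm_le_const (μ := μ)
    (f := fun a => fderiv ℝ (fun u => f (retrAt R x u) a) v w -
      fderiv ℝ (fun u => f (retrAt R x u) a) 0 w)
    (C := C * ‖w‖) (Eventually.of_forall fun a => by
      rw [← _root_.sub_apply]
      exact ContinuousLinearMap.le_of_opNorm_le _ (hC a) w)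
  simpa using h

variable [IsContMDiffRiemannianBundle (𝓡 m) ∞ (EuclideanSpace ℝ (Fin m))
    (fun x : M => TangentSpace (𝓡 m) x)]

theorem IsRegularIntegrand.continuous_mgrad (hf : IsRegularIntegrand R f)
    (hR : IsRetraction 2 R) (a : Ω) :
    Continuous (fun y => (⟨y, mgrad m (fun z => f z a) y⟩ : TangentBundle (𝓡 m) M)) := by
  rw [continuous_iff_continuousAt]
  intro x
  obtain ⟨C, -, hC⟩ := hf.lip.exists_fderiv_le (isCompact_singleton (x := x)) one_pos
  exact hR.continuousAt_mgrad (hf.diff a)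
    (continuousAt_fderiv_of_le one_pos fun u hu => hC x rfl u hu a)

theorem IsRegularIntegrand.continuous_mgrad_integral (hf : IsRegularIntegrand R f)
    (hR : IsRetraction 2 R) :
    Continuous (fun y => (⟨y, mgrad m (fun z => ∫ a, f z a ∂μ) y⟩ : TangentBundle (𝓡 m) M)) := by
  rw [continuous_iff_continuousAt]
  intro x
  obtain ⟨C, hC0, hC⟩ := hf.lip.exists_fderiv_le (isCompact_singleton (x := x)) one_pos
  exact hR.continuousAt_mgrad (hf.mdifferentiable_integral hR)
    (continuousAt_fderiv_of_le one_pos fun u hu =>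
      hf.norm_fderiv_integral_sub_le hR x u (by positivity) fun a => hC x rfl u hu a)

end Expectation

/-! ### Confinement, and Lipschitz estimates along a retraction -/

/-- Moving from `0` along `-g` up to time `κ` does not increase `H` if the slope at `0` dominates
`κ / 2` times the second derivative along the way. -/
theorem apply_neg_smul_le_of_hess_le {V : Type*} [NormedAddCommGroup V] [NormedSpace ℝ V]
    {H : V → ℝ} (hH : ContDiff ℝ 2 H) {g : V} {κ : ℝ} (hκ : 0 < κ)
    (h : ∀ s ∈ Set.Icc (0 : ℝ) κ, κ / 2 * |hess H (-(s • g)) g g| ≤ fderiv ℝ H 0 g)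
    {s : ℝ} (hs : s ∈ Set.Icc (0 : ℝ) κ) : H (-(s • g)) ≤ H 0 := by
  set a := fderiv ℝ H 0 g with ha
  have hline : ∀ s : ℝ, HasDerivAt (fun s : ℝ => -(s • g)) (-g) s := fun s => by
    exact ((hasDerivAt_id s).smul_const g).neg.congr_deriv (by simp)
  have hd1 : ∀ s : ℝ, HasDerivAt (fun s : ℝ => H (-(s • g))) (-fderiv ℝ H (-(s • g)) g) s := by
    intro s
    exact (((hH.differentiable two_ne_zero) (-(s • g))).hasFDerivAt.comp_hasDerivAt s
      (hline s)).congr_deriv (by simp)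
  have hfd : Differentiable ℝ (fderiv ℝ H) :=
    (hH.fderiv_right (m := 1) (by norm_num)).differentiable one_ne_zero
  have hd2 : ∀ s : ℝ, HasDerivAt (fun s : ℝ => fderiv ℝ H (-(s • g)) g)
      (-hess H (-(s • g)) g g) s := by
    intro s
    have h1 := (hfd (-(s • g))).hasFDerivAt.comp_hasDerivAt s (hline s)
    have h2 := h1.clm_apply (hasDerivAt_const s g)
    simpa [hess] using h2
  have hess_le : ∀ s ∈ Set.Icc (0 : ℝ) κ, hess H (-(s • g)) g g ≤ 2 * a / κ := by
    intro s hs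
    rw [le_div_iff₀ hκ]
    have := h s hs
    have := le_abs_self (hess H (-(s • g)) g g)
    nlinarith
  -- Integrating `hess_le` twice: the derivative of `s ↦ H (-(s • g))` at `s` is at most
  -- `2 a s / κ - a`, so `H (-(s • g)) ≤ H 0 - a s + a s ^ 2 / κ`, and `s ≤ κ`.
  have hA1 : ∀ s ∈ Set.Icc (0 : ℝ) κ, -fderiv ℝ H (-(s • g)) g ≤ 2 * a / κ * s - a := by
    intro s hs
    have hanti : AntitoneOn (fun s => -fderiv ℝ H (-(s • g)) g - 2 * a / κ * s)
        (Set.Icc 0 κ) := by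
      have hd : ∀ s : ℝ, HasDerivAt (fun s => -fderiv ℝ H (-(s • g)) g - 2 * a / κ * s)
          (hess H (-(s • g)) g g - 2 * a / κ) s := by
        intro s
        exact ((hd2 s).neg.sub ((hasDerivAt_id s).const_mul (2 * a / κ))).congr_deriv (by simp)
      refine antitoneOn_of_deriv_nonpos (convex_Icc 0 κ)
        (fun s _ => (hd s).continuousAt.continuousWithinAt)
        (fun s _ => (hd s).differentiableAt.differentiableWithinAt) fun s hs => ?_
      rw [(hd s).deriv]
      exact sub_nonpos.2 (hess_le s (interior_subset hs))
    have := hanti (Set.left_mem_Icc.2 hκ.le) hs hs.1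
    simp only [zero_smul, neg_zero, mul_zero, sub_zero] at this
    linarith
  have hanti : AntitoneOn (fun s => H (-(s • g)) + a * s - a / κ * s ^ 2) (Set.Icc 0 κ) := by
    have hd : ∀ s : ℝ, HasDerivAt (fun s => H (-(s • g)) + a * s - a / κ * s ^ 2)
        (-fderiv ℝ H (-(s • g)) g + a - a / κ * (2 * s)) s := by
      intro s
      exact (((hd1 s).add ((hasDerivAt_id s).const_mul a)).sub
        ((hasDerivAt_pow 2 s).const_mul (a / κ))).congr_deriv (by simp)
    refine antitoneOn_of_deriv_nonpos (convex_Icc 0 κ)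
      (fun s _ => (hd s).continuousAt.continuousWithinAt)
      (fun s _ => (hd s).differentiableAt.differentiableWithinAt) fun s hs => ?_
    rw [(hd s).deriv]
    have := hA1 s (interior_subset hs)
    have e : a / κ * (2 * s) = 2 * a / κ * s := by ring
    linarith
  have h3 := hanti (Set.left_mem_Icc.2 hκ.le) hs hs.1
  simp only [zero_smul, neg_zero, mul_zero, add_zero] at h3
  have h4 : 0 ≤ a := (by positivity : (0:ℝ) ≤ κ / 2 * |hess H (-(s • g)) g g|).trans (h s hs)
  have h5 : a / κ * s ^ 2 ≤ a * s := by
    have : a / κ * s ^ 2 = a * s * (s / κ) := by ring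
    rw [this]
    exact mul_le_of_le_one_right (mul_nonneg h4 hs.1) ((div_le_one hκ).2 hs.2)
  nlinarith

section Geometry

variable {m : ℕ} {M : Type*} [TopologicalSpace M] [ChartedSpace (EuclideanSpace ℝ (Fin m)) M]
  [RiemannianBundle (fun x : M => TangentSpace (𝓡 m) x)] [IsManifold (𝓡 m) ∞ M]
  {R : TangentBundle (𝓡 m) M → M} {Ω : Type*} {f : M → Ω → ℝ}

/-- A step of size at most `κ` along `-∇f` does not leave `{ρ ≤ ρ₁}`. -/
theorem IsConfinementWith.apply_step_le (hR : IsRetraction 2 R) {κ ρ₀ ρ₁ : ℝ} {ρ : M → ℝ}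
    (hρ : IsConfinementWith R f κ ρ ρ₀ ρ₁) (hκ : 0 < κ) {s : ℝ} (hs : s ∈ Set.Icc (0 : ℝ) κ)
    (a : Ω) {x : M} (hx : ρ x ≤ ρ₁) :
    ρ (retrAt R x (-(s • mgrad m (fun y => f y a) x))) ≤ ρ₁ := by
  rcases le_total (ρ x) ρ₀ with h | h
  · exact hρ.step_le s hs a x h
  · have hH : ContDiff ℝ 2 (fun u => ρ (retrAt R x u)) := by
      rw [← contMDiff_iff_contDiff]
      exact hρ.contMDiff.comp (hR.contMDiff_retrAt x)
    have h1 := apply_neg_smul_le_of_hess_le hH (g := mgrad m (fun y => f y a) x) hκ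
      (fun s hs => by
        rw [hR.fderiv_comp_zero_apply ((hρ.contMDiff x).mdifferentiableAt two_ne_zero)]
        exact hρ.hess_le s hs a x h hx) hs
    rw [hR.apply_zero x] at h1
    exact h1.trans hx

/-- Uniformly for `y` near `x`, the function `φ ∘ R_y` is Lipschitz at `0_y`. The bound holds on all
of `T_y M` because `φ` takes values in `[0, 1]`: only small vectors have to be treated in a
chart. -/
theorem IsRetraction.eventually_abs_sub_le
    [IsContMDiffRiemannianBundle (𝓡 m) ∞ (EuclideanSpace ℝ (Fin m))
      (fun x : M => TangentSpace (𝓡 m) x)] (hR : IsRetraction 2 R) {φ : M → ℝ}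
    (hφ : ContMDiff (𝓡 m) 𝓘(ℝ, ℝ) 1 φ) (hφ01 : ∀ x, φ x ∈ Set.Icc (0 : ℝ) 1) (x : M) :
    ∃ L : ℝ, ∀ᶠ y in 𝓝 x, ∀ v : TangentSpace (𝓡 m) y,
      |φ (retrAt R y v) - φ y| ≤ L * ‖v‖ := by
  have := isContinuousRiemannianBundle_tangentSpace (m := m) (M := M)
  set p₀ : TangentBundle (𝓡 m) M := ⟨x, 0⟩ with hp₀
  have hh : ContMDiff (𝓡 m).tangent 𝓘(ℝ, ℝ) 1 (fun p => φ (R p)) :=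
    hφ.comp (hR.contMDiff.of_le one_le_two)
  set c := extChartAt (𝓡 m).tangent p₀ with hc
  have hH : ContDiffAt ℝ 1 (fun q => φ (R (c.symm q))) (c p₀) := by
    have := (contMDiffAt_iff.1 (hh p₀)).2
    rw [ModelWithCorners.range_eq_univ, contDiffWithinAt_univ] at this
    exact this
  obtain ⟨K, t, ht, hlip⟩ := hH.exists_lipschitzOnWith
  set T := trivializationAt (EuclideanSpace ℝ (Fin m)) (TangentSpace (𝓡 m) (M := M)) x with hT
  have hbase : ∀ᶠ y in 𝓝 x, y ∈ T.baseSet :=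
    T.open_baseSet.mem_nhds (FiberBundle.mem_baseSet_trivializationAt' x)
  have hsrc : ∀ᶠ y in 𝓝 x, y ∈ (chartAt (EuclideanSpace ℝ (Fin m)) x).source :=
    chart_source_mem_nhds _ x
  have hcv : ∀ y ∈ T.baseSet, ∀ v : TangentSpace (𝓡 m) y,
      c ⟨y, v⟩ = (extChartAt (𝓡 m) x y, T.continuousLinearMapAt ℝ y v) := by
    intro y hy v
    rw [T.continuousLinearMapAt_apply_of_mem ℝ hy, hc, FiberBundle.extChartAt]
    simp [hT]
    exact ⟨rfl, rfl⟩
  have hcs : ∀ y ∈ T.baseSet, y ∈ (chartAt (EuclideanSpace ℝ (Fin m)) x).source →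
      ∀ v : TangentSpace (𝓡 m) y, (⟨y, v⟩ : TangentBundle (𝓡 m) M) ∈ c.source := by
    intro y hy hy' v
    rw [hc, extChartAt_source, TangentBundle.mem_chart_source_iff]
    exact hy'
  have hcp : c p₀ = (extChartAt (𝓡 m) x x, 0) := by
    rw [hp₀, hcv x (FiberBundle.mem_baseSet_trivializationAt' x), map_zero]
  rw [hcp] at ht
  -- In the chart of `TM` at `0_x`, moving from `0_y` to `v` in the fiber over `y` changes only the
  -- fiber coordinate, by the image of `v` in the trivialization, which is `O(‖v‖)`.
  obtain ⟨U, hU, W, hW, hUW⟩ := mem_nhds_prod_iff.1 ht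
  obtain ⟨δ, hδ, hδW⟩ := Metric.mem_nhds_iff.1 hW
  obtain ⟨C, hC, hCe⟩ := eventually_norm_trivializationAt_lt (EuclideanSpace ℝ (Fin m))
    (TangentSpace (𝓡 m) (M := M)) x
  refine ⟨max (K * C) (C / δ), ?_⟩
  filter_upwards [hbase, hsrc, hCe, (continuousAt_extChartAt (I := 𝓡 m) x).eventually_mem hU]
    with y hy hy' hyC hyU v
  have hTv : ‖T.continuousLinearMapAt ℝ y v‖ ≤ C * ‖v‖ :=
    (T.continuousLinearMapAt ℝ y).le_of_opNorm_le hyC.le v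
  by_cases hv : C * ‖v‖ < δ
  · have h1 : c ⟨y, v⟩ ∈ t := by
      rw [hcv y hy]
      exact hUW ⟨hyU, hδW (mem_ball_zero_iff.2 (hTv.trans_lt hv))⟩
    have h2 : c ⟨y, 0⟩ ∈ t := by
      rw [hcv y hy, map_zero]
      exact hUW ⟨hyU, hδW (Metric.mem_ball_self hδ)⟩
    have h3 := hlip.dist_le_mul _ h1 _ h2
    rw [c.left_inv (hcs y hy hy' v), c.left_inv (hcs y hy hy' 0), hcv y hy, hcv y hy, map_zero,
      Prod.dist_eq, dist_self, dist_zero_right, max_eq_right (norm_nonneg _), Real.dist_eq] at h3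
    have h4 : R ⟨y, 0⟩ = y := hR.apply_zero y
    rw [h4] at h3
    calc |φ (retrAt R y v) - φ y| ≤ K * (C * ‖v‖) :=
          h3.trans (mul_le_mul_of_nonneg_left hTv K.2)
      _ = K * C * ‖v‖ := by ring
      _ ≤ _ := mul_le_mul_of_nonneg_right (le_max_left _ _) (norm_nonneg v)
  · have h1 := hφ01 (retrAt R y v)
    have h2 := hφ01 y
    have h3 : |φ (retrAt R y v) - φ y| ≤ 1 := abs_le.2 ⟨by linarith [h1.1, h2.2],
      by linarith [h1.2, h2.1]⟩
    have h4 : 1 ≤ C / δ * ‖v‖ := by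
      rw [div_mul_eq_mul_div, one_le_div hδ]
      exact not_lt.1 hv
    exact h3.trans (h4.trans (mul_le_mul_of_nonneg_right (le_max_right _ _) (norm_nonneg v)))

theorem IsRetraction.exists_abs_sub_le
    [IsContMDiffRiemannianBundle (𝓡 m) ∞ (EuclideanSpace ℝ (Fin m))
      (fun x : M => TangentSpace (𝓡 m) x)] (hR : IsRetraction 2 R) {φ : M → ℝ}
    (hφ : ContMDiff (𝓡 m) 𝓘(ℝ, ℝ) 1 φ) (hφ01 : ∀ x, φ x ∈ Set.Icc (0 : ℝ) 1)
    {K : Set M} (hK : IsCompact K) :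
    ∃ L : ℝ, ∀ y ∈ K, ∀ v : TangentSpace (𝓡 m) y, |φ (retrAt R y v) - φ y| ≤ L * ‖v‖ := by
  refine hK.induction_on (p := fun K => ∃ L : ℝ, ∀ y ∈ K, ∀ v : TangentSpace (𝓡 m) y,
    |φ (retrAt R y v) - φ y| ≤ L * ‖v‖) ⟨0, by simp⟩ ?_ ?_ ?_
  · rintro s t hst ⟨L, hL⟩
    exact ⟨L, fun y hy => hL y (hst hy)⟩
  · rintro s t ⟨L, hL⟩ ⟨L', hL'⟩
    refine ⟨max L L', ?_⟩
    rintro y (hy | hy) v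
    · exact (hL y hy v).trans (mul_le_mul_of_nonneg_right (le_max_left _ _) (norm_nonneg v))
    · exact (hL' y hy v).trans (mul_le_mul_of_nonneg_right (le_max_right _ _) (norm_nonneg v))
  · intro x _
    obtain ⟨L, hL⟩ := hR.eventually_abs_sub_le hφ hφ01 x
    exact ⟨_, mem_nhdsWithin_of_mem_nhds hL, L, fun y hy => hy⟩

end Geometry

/-! ### Real sequences -/

/-- If `∑ η_t = ∞` and `∑ η_t b_t² < ∞`, then `b_t → 0`, provided that for each `δ > 0` the events
`b_t ≤ δ` and `b_t ≥ 2δ` are separated by a sequence `p` whose increments are at most `L η_t`. -/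
theorem tendsto_zero_of_summable_mul_sq {b η : ℕ → ℝ} (hb : ∀ t, 0 ≤ b t) (hη : ∀ t, 0 ≤ η t)
    (hdiv : ¬ Summable η) (hsum : Summable fun t => η t * b t ^ 2)
    (hsep : ∀ δ > 0, ∃ (p : ℕ → ℝ) (L : ℝ), (∀ t, b t ≤ δ → p t = 0) ∧
      (∀ t, 2 * δ ≤ b t → p t = 1) ∧ ∀ t, |p (t + 1) - p t| ≤ L * η t) :
    Tendsto b atTop (𝓝 0) := by
  rw [Metric.tendsto_atTop]
  by_contra! hcon
  obtain ⟨e, he, hfreq⟩ := hcon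
  obtain ⟨p, L, hp0, hp1, hpL⟩ := hsep (e / 2) (by positivity)
  set δ := e / 2 with hδ
  have hδ0 : 0 < δ := by positivity
  have hfreq' : ∀ N, ∃ n ≥ N, 2 * δ ≤ b n := by
    intro N
    obtain ⟨n, hn, hn'⟩ := hfreq N
    rw [Real.dist_eq, sub_zero, abs_of_nonneg (hb n)] at hn'
    exact ⟨n, hn, by linarith⟩
  -- Otherwise `η t ≤ η t * b t ^ 2 / δ ^ 2` eventually, and `η` would be summable.
  have hlow : ∀ N, ∃ n ≥ N, b n ≤ δ := by
    intro N
    by_contra! h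
    refine hdiv ((summable_nat_add_iff N).1 ?_)
    refine Summable.of_nonneg_of_le (fun t => hη _) (fun t => ?_)
      (((summable_nat_add_iff N).2 hsum).mul_left (1 / δ ^ 2))
    have h1 : δ ^ 2 ≤ b (t + N) ^ 2 := by
      have := h (t + N) (by omega)
      gcongr
    rw [one_div, inv_mul_eq_div, le_div_iff₀ (by positivity)]
    exact mul_le_mul_of_nonneg_left h1 (hη _)
  -- Far out, a crossing from `2 δ ≤ b n` to the first `k` with `b k ≤ δ` has `η`-length below
  -- `1 / (|L| + 1)`, too little for `p` to drop from `1` to `0`.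
  obtain ⟨N, hN⟩ : ∃ N, ∀ n ≥ N, ∀ k ≥ n, ∑ t ∈ Finset.Ico n k, η t * b t ^ 2 <
      δ ^ 2 / (|L| + 1) := by
    have h1 := hsum.hasSum.tendsto_sum_nat.cauchySeq
    rw [Metric.cauchySeq_iff'] at h1
    obtain ⟨N, hN⟩ := h1 (δ ^ 2 / (|L| + 1)) (by positivity)
    refine ⟨N, fun n hn k hk => ?_⟩
    have h2 := hN k (hn.le.trans hk)
    rw [Real.dist_eq, ← Finset.sum_Ico_eq_sub _ (hn.le.trans hk)] at h2
    refine lt_of_le_of_lt ?_ ((le_abs_self _).trans_lt h2)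
    exact Finset.sum_le_sum_of_subset_of_nonneg (Finset.Ico_subset_Ico_left hn)
      fun t _ _ => mul_nonneg (hη t) (sq_nonneg _)
  obtain ⟨n, hn, hbn⟩ := hfreq' N
  have hex : ∃ k, n ≤ k ∧ b k ≤ δ := by
    obtain ⟨k, hk, hk'⟩ := hlow n
    exact ⟨k, hk, hk'⟩
  classical
  set k := Nat.find hex with hk
  obtain ⟨hnk, hbk⟩ := Nat.find_spec hex
  have hmid : ∀ t ∈ Finset.Ico n k, δ < b t := by
    intro t ht
    rw [Finset.mem_Ico] at ht
    by_contra! h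
    exact Nat.find_min hex ht.2 ⟨ht.1, h⟩
  have h1 : p k - p n = ∑ t ∈ Finset.Ico n k, (p (t + 1) - p t) := by
    rw [Finset.sum_Ico_eq_sub _ hnk, Finset.sum_range_sub, Finset.sum_range_sub]
    ring
  have h2 : (1 : ℝ) ≤ ∑ t ∈ Finset.Ico n k, |L| * η t := by
    calc (1 : ℝ) = |p k - p n| := by rw [hp0 k hbk, hp1 n hbn]; norm_num
      _ ≤ ∑ t ∈ Finset.Ico n k, |p (t + 1) - p t| := by
          rw [h1]; exact Finset.abs_sum_le_sum_abs _ _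
      _ ≤ _ := Finset.sum_le_sum fun t _ => (hpL t).trans
          (mul_le_mul_of_nonneg_right (le_abs_self L) (hη t))
  have h3 : δ ^ 2 * ∑ t ∈ Finset.Ico n k, η t ≤ ∑ t ∈ Finset.Ico n k, η t * b t ^ 2 := by
    rw [Finset.mul_sum]
    refine Finset.sum_le_sum fun t ht => ?_
    rw [mul_comm]
    have := hmid t ht
    have : δ ^ 2 ≤ b t ^ 2 := by gcongr
    exact mul_le_mul_of_nonneg_left this (hη t)
  have h4 := hN n hn k hnk
  rw [← Finset.mul_sum] at h2
  rw [lt_div_iff₀ (by positivity)] at h4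
  have h5 : 0 ≤ ∑ t ∈ Finset.Ico n k, η t := Finset.sum_nonneg fun t _ => hη t
  have h6 : δ ^ 2 * (∑ t ∈ Finset.Ico n k, η t) * (|L| + 1) < δ ^ 2 :=
    (mul_le_mul_of_nonneg_right h3 (by positivity)).trans_lt h4
  have h7 : (∑ t ∈ Finset.Ico n k, η t) * (|L| + 1) < 1 := by
    have : δ ^ 2 * ((∑ t ∈ Finset.Ico n k, η t) * (|L| + 1)) < δ ^ 2 * 1 := by linarith
    exact lt_of_mul_lt_mul_left this (by positivity)
  nlinarith

/-- Convexity of `u ↦ u ^ (-p)`: the graph lies above its tangent at `v`. -/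
theorem rpow_neg_sub_rpow_neg_ge {u v p : ℝ} (hu : 0 < u) (huv : u ≤ v) (hp : 0 < p) :
    p * ((v - u) * v ^ (-(1 + p))) ≤ u ^ (-p) - v ^ (-p) := by
  have hv : 0 < v := hu.trans_le huv
  have h1 : u ^ (-p) = v ^ (-p) * Real.exp (p * Real.log (v / u)) := by
    rw [Real.rpow_def_of_pos hu, Real.rpow_def_of_pos hv, ← Real.exp_add,
      Real.log_div hv.ne' hu.ne']
    ring_nf
  have h2 : 1 - u / v ≤ Real.log (v / u) := by
    have := Real.one_sub_inv_le_log_of_pos (div_pos hv hu)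
    rwa [inv_div] at this
  have h3 : 1 + p * (1 - u / v) ≤ Real.exp (p * Real.log (v / u)) := by
    have := Real.add_one_le_exp (p * Real.log (v / u))
    nlinarith
  have h4 : v ^ (-(1 + p)) = v ^ (-p) / v := by
    rw [show -(1 + p) = -p - 1 by ring, Real.rpow_sub_one hv.ne']
  have h5 : 0 < v ^ (-p) := Real.rpow_pos_of_pos hv _
  rw [h1, h4]
  have h6 : p * ((v - u) * (v ^ (-p) / v)) = v ^ (-p) * (p * (1 - u / v)) := by
    field_simp
  rw [h6]
  nlinarith

/-- The partial sums of `q_t / G_t ^ (1 + p)`, where `G_t = β + q_0 + ⋯ + q_{t-1}` and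
`0 ≤ q_t ≤ Q`, are bounded. Since `G_{t+1} ≤ (1 + Q / β) G_t`, one may replace
`G_t` by `G_{t+1}`, and the result is dominated by the telescoping sum of
`G_t ^ (-p) - G_{t+1} ^ (-p)`. -/
theorem sum_div_rpow_le {q : ℕ → ℝ} {Q β p : ℝ} (hq : ∀ t, 0 ≤ q t) (hqQ : ∀ t, q t ≤ Q)
    (hβ : 0 < β) (hp : 0 < p) (n : ℕ) :
    ∑ t ∈ Finset.range n, q t / (β + ∑ s ∈ Finset.range t, q s) ^ (1 + p) ≤
      (1 + Q / β) ^ (1 + p) * β ^ (-p) / p := by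
  set G : ℕ → ℝ := fun t => β + ∑ s ∈ Finset.range t, q s with hG
  have hGs : ∀ t, G (t + 1) = G t + q t := fun t => by
    simp only [hG, Finset.sum_range_succ, add_assoc]
  have hGβ : ∀ t, β ≤ G t := fun t => le_add_of_nonneg_right (Finset.sum_nonneg fun s _ => hq s)
  have hGpos : ∀ t, 0 < G t := fun t => hβ.trans_le (hGβ t)
  have hQ : 0 ≤ Q := (hq 0).trans (hqQ 0)
  have hterm : ∀ t, q t / G t ^ (1 + p) ≤
      (1 + Q / β) ^ (1 + p) / p * (G t ^ (-p) - G (t + 1) ^ (-p)) := by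
    intro t
    have h1 := rpow_neg_sub_rpow_neg_ge (hGpos t)
      (by rw [hGs]; linarith [hq t] : G t ≤ G (t + 1)) hp
    have h2 : G (t + 1) ≤ (1 + Q / β) * G t := by
      rw [hGs, add_mul, one_mul, div_mul_eq_mul_div]
      have : Q ≤ Q * G t / β := by
        rw [le_div_iff₀ hβ]
        exact mul_le_mul_of_nonneg_left (hGβ t) hQ
      linarith [hqQ t]
    have h3 : G (t + 1) ^ (1 + p) ≤ (1 + Q / β) ^ (1 + p) * G t ^ (1 + p) := by
      rw [← Real.mul_rpow (by positivity) (hGpos t).le]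
      exact Real.rpow_le_rpow (hGpos _).le h2 (by positivity)
    have h4 : G (t + 1) - G t = q t := by rw [hGs]; ring
    rw [h4, Real.rpow_neg (hGpos _).le, ← div_eq_mul_inv] at h1
    have h5 : q t / G t ^ (1 + p) ≤ (1 + Q / β) ^ (1 + p) * (q t / G (t + 1) ^ (1 + p)) := by
      have e1 : 0 < G t ^ (1 + p) := Real.rpow_pos_of_pos (hGpos _) _
      have e2 : 0 < G (t + 1) ^ (1 + p) := Real.rpow_pos_of_pos (hGpos _) _
      rw [← mul_div_assoc, div_le_div_iff₀ e1 e2]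
      nlinarith [mul_le_mul_of_nonneg_left h3 (hq t)]
    refine h5.trans ?_
    rw [div_mul_eq_mul_div, mul_div_assoc]
    refine mul_le_mul_of_nonneg_left ?_ (by positivity)
    rw [le_div_iff₀ hp, mul_comm]
    exact h1
  calc ∑ t ∈ Finset.range n, q t / G t ^ (1 + p)
      ≤ ∑ t ∈ Finset.range n,
          (1 + Q / β) ^ (1 + p) / p * (G t ^ (-p) - G (t + 1) ^ (-p)) :=
        Finset.sum_le_sum fun t _ => hterm t
    _ = (1 + Q / β) ^ (1 + p) / p * (G 0 ^ (-p) - G n ^ (-p)) := by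
        rw [← Finset.mul_sum, Finset.sum_range_sub']
    _ ≤ (1 + Q / β) ^ (1 + p) / p * β ^ (-p) := by
        refine mul_le_mul_of_nonneg_left ?_ (by positivity)
        have : 0 ≤ G n ^ (-p) := Real.rpow_nonneg (hGpos n).le _
        have e : G 0 = β := by simp [hG]
        rw [e]; linarith
    _ = _ := by ring

/-- The step sizes decay no faster than `1 / t`, so their sum is infinite. -/
theorem not_summable_div_rpow {q : ℕ → ℝ} {Q α β c : ℝ} (hq : ∀ t, 0 ≤ q t) (hqQ : ∀ t, q t ≤ Q)
    (hα : 0 < α) (hβ : 0 < β) (hc0 : 0 ≤ c) (hc : c ≤ 1) :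
    ¬ Summable fun t => α / (β + ∑ s ∈ Finset.range t, q s) ^ c := by
  intro hsum
  set D := max 1 (max β Q) with hD
  have hD1 : 1 ≤ D := le_max_left _ _
  have hle : ∀ t : ℕ, (β + ∑ s ∈ Finset.range t, q s) ^ c ≤ D * ((t + 1 : ℕ) : ℝ) := by
    intro t
    have h1 : ∑ s ∈ Finset.range t, q s ≤ t * D := by
      calc ∑ s ∈ Finset.range t, q s ≤ ∑ s ∈ Finset.range t, D :=
            Finset.sum_le_sum fun s _ => (hqQ s).trans ((le_max_right _ _).trans (le_max_right _ _))
        _ = t * D := by simp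
    have h0 : 0 ≤ ∑ s ∈ Finset.range t, q s := Finset.sum_nonneg fun s _ => hq s
    have h2 : β + ∑ s ∈ Finset.range t, q s ≤ D * ((t + 1 : ℕ) : ℝ) := by
      push_cast
      have : β ≤ D := (le_max_left _ _).trans (le_max_right _ _)
      linarith
    have h3 : 1 ≤ D * ((t + 1 : ℕ) : ℝ) := by
      have : (1 : ℝ) ≤ ((t + 1 : ℕ) : ℝ) := by exact_mod_cast Nat.le_add_left 1 t
      nlinarith
    calc (β + ∑ s ∈ Finset.range t, q s) ^ c ≤ (D * ((t + 1 : ℕ) : ℝ)) ^ c :=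
          Real.rpow_le_rpow (by linarith) h2 hc0
      _ ≤ (D * ((t + 1 : ℕ) : ℝ)) ^ (1 : ℝ) := Real.rpow_le_rpow_of_exponent_le h3 hc
      _ = _ := Real.rpow_one _
  have h : Summable fun t : ℕ => 1 / ((t + 1 : ℕ) : ℝ) := by
    refine Summable.of_nonneg_of_le (fun t => by positivity) (fun t => ?_) (hsum.mul_left (D / α))
    have h0 : 0 ≤ ∑ s ∈ Finset.range t, q s := Finset.sum_nonneg fun s _ => hq s
    have hpos : 0 < (β + ∑ s ∈ Finset.range t, q s) ^ c := Real.rpow_pos_of_pos (by linarith) _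
    rw [div_mul_div_comm, mul_comm D α, mul_div_mul_left _ _ hα.ne',
      div_le_div_iff₀ (by positivity) hpos, one_mul]
    exact hle t
  exact Real.not_summable_one_div_natCast ((summable_nat_add_iff 1).1 h)

/-! ### Independence and joint measurability -/

section Prob

theorem integral_comp_eq_of_indepFun {S Z Ω : Type*} [MeasurableSpace S] [MeasurableSpace Z]
    [MeasurableSpace Ω] {P : Measure S} [IsProbabilityMeasure P] {X : S → Z} {W : S → Ω}
    (hX : Measurable X) (hW : Measurable W) (hXW : IndepFun X W P) {Ψ : Z → Ω → ℝ}
    (hΨ : Measurable (Function.uncurry Ψ)) (hint : Integrable (fun ξ => Ψ (X ξ) (W ξ)) P) :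
    ∫ ξ, Ψ (X ξ) (W ξ) ∂P = ∫ ξ, ∫ a, Ψ (X ξ) a ∂(P.map W) ∂P := by
  have := Measure.isProbabilityMeasure_map hX.aemeasurable (μ := P)
  have := Measure.isProbabilityMeasure_map hW.aemeasurable (μ := P)
  have hmap := (indepFun_iff_map_prod_eq_prod_map_map hX.aemeasurable hW.aemeasurable).1 hXW
  have hXWm : Measurable fun ξ => (X ξ, W ξ) := hX.prodMk hW
  have h1 : ∫ ξ, Ψ (X ξ) (W ξ) ∂P =
      ∫ q, Function.uncurry Ψ q ∂(P.map fun ξ => (X ξ, W ξ)) := by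
    rw [integral_map hXWm.aemeasurable hΨ.aestronglyMeasurable]
    rfl
  have h2 : Integrable (Function.uncurry Ψ) ((P.map X).prod (P.map W)) := by
    rw [← hmap, integrable_map_measure hΨ.aestronglyMeasurable hXWm.aemeasurable]
    exact hint
  rw [h1, hmap, integral_prod _ h2, integral_map hX.aemeasurable]
  · rfl
  · exact h2.aestronglyMeasurable.integral_prod_right'

theorem ae_summable_of_sum_integral_le {S : Type*} [MeasurableSpace S] {P : Measure S}
    {Y : ℕ → S → ℝ} (hY0 : ∀ t ξ, 0 ≤ Y t ξ) (hYi : ∀ t, Integrable (Y t) P) {c : ℝ}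
    (hc : ∀ n, ∑ t ∈ Finset.range n, ∫ ξ, Y t ξ ∂P ≤ c) :
    ∀ᵐ ξ ∂P, Summable fun t => Y t ξ := by
  have hs : Summable fun t => ∫ ξ, Y t ξ ∂P :=
    summable_of_sum_range_le (fun t => integral_nonneg (hY0 t)) hc
  have h1 : ∫⁻ ξ, ∑' t, ENNReal.ofReal (Y t ξ) ∂P ≠ ⊤ := by
    rw [lintegral_tsum fun t => (hYi t).aemeasurable.ennreal_ofReal]
    have : ∀ t, ∫⁻ ξ, ENNReal.ofReal (Y t ξ) ∂P = ENNReal.ofReal (∫ ξ, Y t ξ ∂P) := fun t =>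
      (ofReal_integral_eq_lintegral_ofReal (hYi t) (Eventually.of_forall (hY0 t))).symm
    simp_rw [this]
    exact hs.tsum_ofReal_ne_top
  have h2 := ae_lt_top' (AEMeasurable.tsum fun t =>
    (hYi t).aemeasurable.ennreal_ofReal) h1
  filter_upwards [h2] with ξ hξ
  have := ENNReal.summable_toReal hξ.ne
  simpa only [ENNReal.toReal_ofReal (hY0 _ ξ)] using this

/-- The σ-algebra on `S` generated by the samples `w 0, …, w (t - 1)`. -/
abbrev past {S Ω : Type*} [MeasurableSpace Ω] (w : ℕ → S → Ω) (t : ℕ) : MeasurableSpace S :=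
  ⨆ s ∈ Set.Iio t, MeasurableSpace.comap (w s) inferInstance

theorem past_mono {S Ω : Type*} [MeasurableSpace Ω] (w : ℕ → S → Ω) : Monotone (past w) :=
  fun _ _ h => biSup_mono fun _ hs => lt_of_lt_of_le hs h

theorem measurable_past {S Ω : Type*} [MeasurableSpace Ω] (w : ℕ → S → Ω) (t : ℕ) :
    Measurable[past w (t + 1)] (w t) := by
  rw [measurable_iff_comap_le]
  exact le_biSup (fun s => MeasurableSpace.comap (w s) inferInstance)
    (show t ∈ Set.Iio (t + 1) from Nat.lt_succ_self t)

theorem past_le {S Ω : Type*} [MeasurableSpace S] [MeasurableSpace Ω] {w : ℕ → S → Ω}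
    (hw : ∀ t, Measurable (w t)) (t : ℕ) : past w t ≤ ‹MeasurableSpace S› :=
  iSup₂_le fun s _ => (hw s).comap_le

theorem indepFun_of_measurable_past {S Z Ω : Type*} [MeasurableSpace S] [MeasurableSpace Z]
    [MeasurableSpace Ω] {P : Measure S} {w : ℕ → S → Ω}
    (hw : ∀ t, Measurable (w t)) (hind : iIndepFun w P) {t : ℕ} {X : S → Z}
    (hX : Measurable[past w t] X) : IndepFun X (w t) P := by
  have h := indep_iSup_of_disjoint (fun s => (hw s).comap_le) hind
    (S := Set.Iio t) (T := {t}) (by simp)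
  rw [IndepFun_iff_Indep]
  refine indep_of_indep_of_le_left (indep_of_indep_of_le_right h ?_) hX.comap_le
  simp

end Prob

section Measurability

theorem metrizableSpace_of_chartedSpace (m : ℕ) (M : Type*) [TopologicalSpace M] [T2Space M]
    [SecondCountableTopology M] [ChartedSpace (EuclideanSpace ℝ (Fin m)) M] :
    TopologicalSpace.MetrizableSpace M := by
  have := ChartedSpace.locallyCompactSpace (EuclideanSpace ℝ (Fin m)) M
  exact Manifold.metrizableSpace (𝓡 m) M

variable {m : ℕ} {M : Type*} [TopologicalSpace M] [ChartedSpace (EuclideanSpace ℝ (Fin m)) M]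

instance finiteDimensional_tangentSpace (x : M) : FiniteDimensional ℝ (TangentSpace (𝓡 m) x) :=
  inferInstanceAs (FiniteDimensional ℝ (EuclideanSpace ℝ (Fin m)))

theorem continuous_smul_section [IsManifold (𝓡 m) ∞ M] {u : ∀ x : M, TangentSpace (𝓡 m) x}
    (hu : Continuous (fun x => (⟨x, u x⟩ : TangentBundle (𝓡 m) M))) :
    Continuous (fun q : ℝ × M => (⟨q.2, q.1 • u q.2⟩ : TangentBundle (𝓡 m) M)) := by
  rw [continuous_iff_continuousAt]
  rintro ⟨s, x⟩
  rw [FiberBundle.continuousAt_totalSpace]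
  refine ⟨continuousAt_snd, ?_⟩
  have h1 := ((FiberBundle.continuousAt_totalSpace _ _).1 (hu.continuousAt (x := x))).2
  have h2 : ContinuousAt (fun q : ℝ × M => q.1 • (trivializationAt (EuclideanSpace ℝ (Fin m))
      (TangentSpace (𝓡 m)) x (⟨q.2, u q.2⟩ : TangentBundle (𝓡 m) M)).2) (s, x) :=
    continuousAt_fst.smul (ContinuousAt.comp_of_eq (f := fun q : ℝ × M => q.2) h1
      continuousAt_snd rfl)
  refine h2.congr ?_
  set T := trivializationAt (EuclideanSpace ℝ (Fin m)) (TangentSpace (𝓡 m) (M := M)) x with hT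
  have hbase : ∀ᶠ y in 𝓝 x, y ∈ T.baseSet :=
    T.open_baseSet.mem_nhds (FiberBundle.mem_baseSet_trivializationAt' x)
  filter_upwards [continuousAt_snd.eventually hbase] with q hq
  have := map_smul (T.continuousLinearMapAt ℝ q.2) q.1 (u q.2)
  rw [T.continuousLinearMapAt_apply_of_mem ℝ hq, T.continuousLinearMapAt_apply_of_mem ℝ hq] at this
  exact this.symm

variable [RiemannianBundle (fun x : M => TangentSpace (𝓡 m) x)] [IsManifold (𝓡 m) ∞ M]
  {R : TangentBundle (𝓡 m) M → M} {Ω : Type*} [MeasurableSpace Ω] {f : M → Ω → ℝ}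

/-- Measurability of `∇f(x, ·)`, phrased through continuous functions `h` on `T_x M` so that no
σ-algebra on `T_x M` is needed. -/
theorem IsRegularIntegrand.measurable_comp_mgrad (hf : IsRegularIntegrand R f)
    (hR : IsRetraction 2 R) (x : M) {Y : Type*} [TopologicalSpace Y] [MeasurableSpace Y]
    [BorelSpace Y] {h : TangentSpace (𝓡 m) x → Y} (hh : Continuous h) :
    Measurable fun a => h (mgrad m (fun y => f y a) x) := by
  let b := stdOrthonormalBasis ℝ (TangentSpace (𝓡 m) x)
  have h1 : ∀ a, mgrad m (fun y => f y a) x =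
      ∑ i, inner ℝ (mgrad m (fun y => f y a) x) (b i) • b i := fun a => by
    conv_lhs => rw [← b.sum_repr' (mgrad m (fun y => f y a) x)]
    simp only [real_inner_comm]
  have h2 : Measurable fun a => fun i => inner ℝ (mgrad m (fun y => f y a) x) (b i) :=
    measurable_pi_lambda _ fun i => hf.measurable_inner hR x (b i)
  have h3 : Continuous fun c : Fin (Module.finrank ℝ (TangentSpace (𝓡 m) x)) → ℝ =>
      h (∑ i, c i • b i) := by
    fun_prop
  have h4 := h3.measurable.comp h2
  simp only [Function.comp_def, ← h1] at h4
  exact h4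

variable [T2Space M] [SecondCountableTopology M]
  [IsContMDiffRiemannianBundle (𝓡 m) ∞ (EuclideanSpace ℝ (Fin m))
    (fun x : M => TangentSpace (𝓡 m) x)] [MeasurableSpace M] [BorelSpace M]

/-- The update map `(s, x, ω) ↦ R_x (-s ∇f(x, ω))` is jointly measurable: it is continuous in
`(s, x)` and measurable in `ω`. -/
theorem IsRegularIntegrand.measurable_step (hf : IsRegularIntegrand R f)
    (hR : IsRetraction 2 R) :
    Measurable fun q : (ℝ × M) × Ω =>
      retrAt R q.1.2 (-(q.1.1 • mgrad m (fun y => f y q.2) q.1.2)) := by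
  have := metrizableSpace_of_chartedSpace m M
  refine measurable_uncurry_of_continuous_of_measurable (u := fun (i : ℝ × M) (a : Ω) =>
    retrAt R i.2 (-(i.1 • mgrad m (fun y => f y a) i.2))) ?_ ?_
  · intro a
    have h1 := (continuous_smul_section (hf.continuous_mgrad hR a)).comp
      ((continuous_fst.neg.prodMk continuous_snd) : Continuous fun q : ℝ × M => (-q.1, q.2))
    have h2 := hR.contMDiff.continuous.comp h1
    simpa only [Function.comp_def, retrAt, neg_smul, Pi.neg_apply] using h2
  · rintro ⟨s, x⟩
    exact hf.measurable_comp_mgrad hR x (h := fun v => retrAt R x (-(s • v)))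
      ((hR.contMDiff_retrAt x).continuous.comp (continuous_const_smul s).neg)

theorem IsRegularIntegrand.measurable_inner_section (hf : IsRegularIntegrand R f)
    (hR : IsRetraction 2 R) {u : ∀ x : M, TangentSpace (𝓡 m) x}
    (hu : Continuous (fun x => (⟨x, u x⟩ : TangentBundle (𝓡 m) M))) :
    Measurable fun q : M × Ω => (inner ℝ (u q.1) (mgrad m (fun y => f y q.2) q.1) : ℝ) := by
  have := metrizableSpace_of_chartedSpace m M
  have := isContinuousRiemannianBundle_tangentSpace (m := m) (M := M)
  refine measurable_uncurry_of_continuous_of_measurable (u := fun (x : M) (a : Ω) =>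
    (inner ℝ (u x) (mgrad m (fun y => f y a) x) : ℝ)) ?_ ?_
  · exact fun a => Continuous.inner_bundle hu (hf.continuous_mgrad hR a)
  · exact fun x => hf.measurable_comp_mgrad hR x (continuous_const.inner continuous_id)

theorem IsRegularIntegrand.measurable_norm_sq (hf : IsRegularIntegrand R f)
    (hR : IsRetraction 2 R) :
    Measurable fun q : M × Ω => ‖mgrad m (fun y => f y q.2) q.1‖ ^ 2 := by
  have := metrizableSpace_of_chartedSpace m M
  have := isContinuousRiemannianBundle_tangentSpace (m := m) (M := M)
  refine measurable_uncurry_of_continuous_of_measurable (u := fun (x : M) (a : Ω) =>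
    ‖mgrad m (fun y => f y a) x‖ ^ 2) ?_ ?_
  · intro a
    simp only [← real_inner_self_eq_norm_sq]
    exact Continuous.inner_bundle (hf.continuous_mgrad hR a) (hf.continuous_mgrad hR a)
  · exact fun x => hf.measurable_comp_mgrad hR x (continuous_norm.pow 2)

theorem IsRegularIntegrand.measurable_step_comp (hf : IsRegularIntegrand R f)
    (hR : IsRetraction 2 R) {S : Type*} {_ : MeasurableSpace S} {X : S → M} {H : S → ℝ} {W : S → Ω}
    (hX : Measurable X) (hH : Measurable H) (hW : Measurable W) :
    Measurable fun ξ => retrAt R (X ξ) (-(H ξ • mgrad m (fun y => f y (W ξ)) (X ξ))) :=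
  (hf.measurable_step hR).comp ((hH.prodMk hX).prodMk hW)

theorem IsRegularIntegrand.measurable_norm_sq_comp (hf : IsRegularIntegrand R f)
    (hR : IsRetraction 2 R) {S : Type*} {_ : MeasurableSpace S} {X : S → M} {W : S → Ω}
    (hX : Measurable X) (hW : Measurable W) :
    Measurable fun ξ => ‖mgrad m (fun y => f y (W ξ)) (X ξ)‖ ^ 2 := by
  have h := (hf.measurable_norm_sq hR).comp (hX.prodMk hW)
  simp only [Function.comp_def] at h
  exact h

/-- The iterate and the step size at time `t` depend measurably on the samples before time `t`. -/
theorem IsRegularIntegrand.measurable_sgd (hf : IsRegularIntegrand R f) (hR : IsRetraction 2 R)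
    (α β ε : ℝ) (x₀ : M) {S : Type*} (w : ℕ → S → Ω) (t : ℕ) :
    Measurable[past w t] (fun ξ => (sgd R f α β ε x₀ (fun s => w s ξ) t,
      stepSize m f α β ε (fun s => w s ξ) (sgd R f α β ε x₀ (fun s => w s ξ)) t)) := by
  have hη : ∀ (m' : MeasurableSpace S) (t : ℕ), Measurable[m'] (fun ξ => ∑ s ∈ Finset.range t,
      ‖mgrad m (fun y => f y (w s ξ)) (sgd R f α β ε x₀ (fun s => w s ξ) s)‖ ^ 2) →
      Measurable[m'] (fun ξ =>
        stepSize m f α β ε (fun s => w s ξ) (sgd R f α β ε x₀ (fun s => w s ξ)) t) := by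
    intro m' t h
    unfold stepSize
    exact ((h.const_add β).pow_const _).const_div α
  have key : ∀ t, Measurable[past w t] (fun ξ => sgd R f α β ε x₀ (fun s => w s ξ) t) ∧
      Measurable[past w t] (fun ξ => ∑ s ∈ Finset.range t,
        ‖mgrad m (fun y => f y (w s ξ)) (sgd R f α β ε x₀ (fun s => w s ξ) s)‖ ^ 2) := by
    intro t
    induction t with
    | zero =>
      simp only [sgd_zero, Finset.range_zero, Finset.sum_empty]
      exact ⟨measurable_const, measurable_const⟩
    | succ t ih =>
      have hle := past_mono w t.le_succ
      have hw := measurable_past w t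
      have h1 := ih.1.mono hle le_rfl
      have h2 := ih.2.mono hle le_rfl
      simp only [sgd_succ, Finset.sum_range_succ]
      exact ⟨hf.measurable_step_comp hR h1 (hη _ t h2) hw,
        h2.add (hf.measurable_norm_sq_comp hR h1 hw)⟩
  exact (key t).1.prodMk (hη _ t (key t).2)

end Measurability

/-! ### Convergence of the iterates -/

section Convergence

variable {m : ℕ} {M : Type*} [TopologicalSpace M] [ChartedSpace (EuclideanSpace ℝ (Fin m)) M]
  [RiemannianBundle (fun x : M => TangentSpace (𝓡 m) x)]
  {R : TangentBundle (𝓡 m) M → M} {Ω : Type*} {f : M → Ω → ℝ}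

theorem stepSize_pos {α β ε : ℝ} (hα : 0 < α) (hβ : 0 < β) (w : ℕ → Ω) (x : ℕ → M) (t : ℕ) :
    0 < stepSize m f α β ε w x t := by
  unfold stepSize
  have : 0 ≤ ∑ s ∈ Finset.range t, ‖mgrad m (fun y => f y (w s)) (x s)‖ ^ 2 :=
    Finset.sum_nonneg fun _ _ => sq_nonneg _
  positivity

theorem stepSize_le {α β ε : ℝ} (hα : 0 < α) (hβ : 0 < β) (hε : 0 < ε) (w : ℕ → Ω) (x : ℕ → M)
    (t : ℕ) : stepSize m f α β ε w x t ≤ α / β ^ (1 / 2 + ε) := by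
  unfold stepSize
  have h : 0 ≤ ∑ s ∈ Finset.range t, ‖mgrad m (fun y => f y (w s)) (x s)‖ ^ 2 :=
    Finset.sum_nonneg fun _ _ => sq_nonneg _
  gcongr
  linarith

variable [IsManifold (𝓡 m) ∞ M]

theorem IsConfinementWith.sgd_le (hR : IsRetraction 2 R) {κ ρ₀ ρ₁ : ℝ} {ρ : M → ℝ}
    (hρ : IsConfinementWith R f κ ρ ρ₀ ρ₁) (hκ : 0 < κ) {α β ε : ℝ} (hα : 0 < α) (hβ : 0 < β)
    (hε : 0 < ε) (hαβ : α / β ^ (1 / 2 + ε) ≤ κ) {x₀ : M} (hx₀ : ρ x₀ ≤ ρ₁) (w : ℕ → Ω) (t : ℕ) :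
    ρ (sgd R f α β ε x₀ w t) ≤ ρ₁ := by
  induction t with
  | zero => rwa [sgd_zero]
  | succ t ih =>
    rw [sgd_succ]
    exact hρ.apply_step_le hR hκ
      ⟨(stepSize_pos hα hβ _ _ _).le, (stepSize_le hα hβ hε _ _ _).trans hαβ⟩ (w t) ih

variable [MeasurableSpace Ω]

theorem IsRegularIntegrand.norm_mgrad_integral_le (hf : IsRegularIntegrand R f)
    (hR : IsRetraction 2 R) (μ : Measure Ω) [IsProbabilityMeasure μ] {x : M} {B : ℝ}
    (hB : ∀ a, ‖mgrad m (fun y => f y a) x‖ ≤ B) :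
    ‖mgrad m (fun y => ∫ a, f y a ∂μ) x‖ ≤ B := by
  set u := mgrad m (fun y => ∫ a, f y a ∂μ) x with hu
  have h1 : ‖u‖ ^ 2 ≤ B * ‖u‖ := by
    rw [← real_inner_self_eq_norm_sq]
    conv_lhs => rw [hu, hf.inner_mgrad_integral hR, ← hu]
    calc ∫ a, inner ℝ (mgrad m (fun y => f y a) x) u ∂μ ≤ ∫ _, B * ‖u‖ ∂μ :=
          integral_mono (hf.integrable_inner hR μ x u) (integrable_const _) fun a =>
            (real_inner_le_norm _ _).trans (mul_le_mul_of_nonneg_right (hB a) (norm_nonneg u))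
      _ = B * ‖u‖ := by simp
  by_contra! h2
  obtain ⟨a⟩ := nonempty_of_isProbabilityMeasure μ
  have h3 : 0 < ‖u‖ := ((norm_nonneg _).trans (hB a)).trans_lt h2
  nlinarith

/-- Descent inequality for the expectation along the retraction, uniform on compact sets. -/
theorem IsRegularIntegrand.exists_integral_step_le (hf : IsRegularIntegrand R f)
    (hR : IsRetraction 2 R) (μ : Measure Ω) [IsProbabilityMeasure μ] {K : Set M} (hK : IsCompact K)
    {r : ℝ} (hr : 0 < r) :
    ∃ C : ℝ, 0 < C ∧ ∀ x ∈ K, ∀ v : TangentSpace (𝓡 m) x, ‖v‖ ≤ r →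
      ∫ a, f (retrAt R x v) a ∂μ ≤
        ∫ a, f x a ∂μ + inner ℝ (mgrad m (fun y => ∫ a, f y a ∂μ) x) v + C * ‖v‖ ^ 2 := by
  obtain ⟨C, hC0, hC⟩ := hf.lip.exists_fderiv_le hK hr
  refine ⟨C, hC0, fun x hx v hv => ?_⟩
  have h := hR.abs_sub_inner_mgrad_le (hf.mdifferentiable_integral hR (μ := μ)) hC0.le
    (fun u hu => hf.norm_fderiv_integral_sub_le hR x u (by positivity)
      fun a => hC x hx u hu a) hv
  linarith [le_abs_self (∫ a, f (retrAt R x v) a ∂μ - ∫ a, f x a ∂μ -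
    inner ℝ (mgrad m (fun y => ∫ a, f y a ∂μ) x) v)]

variable [IsContMDiffRiemannianBundle (𝓡 m) ∞ (EuclideanSpace ℝ (Fin m))
  (fun x : M => TangentSpace (𝓡 m) x)]

theorem IsRegularIntegrand.continuous_norm_mgrad_integral (hf : IsRegularIntegrand R f)
    (hR : IsRetraction 2 R) (μ : Measure Ω) [IsProbabilityMeasure μ] :
    Continuous fun x => ‖mgrad m (fun y => ∫ a, f y a ∂μ) x‖ := by
  have := isContinuousRiemannianBundle_tangentSpace (m := m) (M := M)
  have h : Continuous fun x : M => (inner ℝ (mgrad m (fun y => ∫ a, f y a ∂μ) x)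
      (mgrad m (fun y => ∫ a, f y a ∂μ) x) : ℝ) :=
    Continuous.inner_bundle (hf.continuous_mgrad_integral hR) (hf.continuous_mgrad_integral hR)
  simp only [real_inner_self_eq_norm_sq] at h
  simpa only [Real.sqrt_sq (norm_nonneg _)] using h.sqrt

variable [T2Space M] [SecondCountableTopology M]

/-- For an adapted sequence of iterates `X` in a compact set, with step sizes `H` such that
`∑ H_t² ‖∇f(X_t, w_t)‖²` is bounded, `∑ H_t ‖∇F(X_t)‖²` is finite almost surely: its expectation
is bounded by summing the descent inequality for `F`. -/
theorem IsRegularIntegrand.ae_summable_mul_sq (hf : IsRegularIntegrand R f)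
    (hR : IsRetraction 2 R) [MeasurableSpace M] [BorelSpace M] {μ : Measure Ω}
    [IsProbabilityMeasure μ] {S : Type*} [MeasurableSpace S] {P : Measure S}
    [IsProbabilityMeasure P] {w : ℕ → S → Ω} (hw : ∀ t, Measurable (w t)) (hind : iIndepFun w P)
    (hlaw : ∀ t, P.map (w t) = μ) {K : Set M} (hK : IsCompact K) {X : ℕ → S → M} {H : ℕ → S → ℝ}
    (hmeas : ∀ t, Measurable[past w t] fun ξ => (X t ξ, H t ξ)) (hXK : ∀ t ξ, X t ξ ∈ K)
    (hstep : ∀ t ξ, X (t + 1) ξ =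
      retrAt R (X t ξ) (-(H t ξ • mgrad m (fun y => f y (w t ξ)) (X t ξ))))
    {κ : ℝ} (hH0 : ∀ t ξ, 0 ≤ H t ξ) (hHκ : ∀ t ξ, H t ξ ≤ κ) {c : ℝ}
    (hc : ∀ ξ n, ∑ t ∈ Finset.range n,
      H t ξ ^ 2 * ‖mgrad m (fun y => f y (w t ξ)) (X t ξ)‖ ^ 2 ≤ c) :
    ∀ᵐ ξ ∂P, Summable fun t => H t ξ * ‖mgrad m (fun y => ∫ a, f y a ∂μ) (X t ξ)‖ ^ 2 := by
  obtain ⟨ξ₀⟩ := nonempty_of_isProbabilityMeasure P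
  have hκ0 : 0 ≤ κ := (hH0 0 ξ₀).trans (hHκ 0 ξ₀)
  set F : M → ℝ := fun y => ∫ a, f y a ∂μ with hF
  obtain ⟨D, hD0, hD⟩ := hf.bdd K hK
  obtain ⟨B, hB0, hB⟩ := hf.grad_bdd K hK
  simp only [abs_norm] at hB
  obtain ⟨C, hC0, hC⟩ := hf.exists_integral_step_le hR μ hK (r := κ * B + 1) (by positivity)
  have hFD : ∀ x ∈ K, |F x| ≤ D := fun x hx => by
    have := norm_integral_le_of_norm_le_const (μ := μ) (f := f x) (C := D)
      (Eventually.of_forall fun a => hD x hx a)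
    simpa using this
  have hFB : ∀ x ∈ K, ‖mgrad m F x‖ ≤ B := fun x hx =>
    hf.norm_mgrad_integral_le hR μ (hB x hx)
  have hXm : ∀ t, Measurable (X t) := fun t => ((hmeas t).mono (past_le hw t) le_rfl).fst
  have hHm : ∀ t, Measurable (H t) := fun t => ((hmeas t).mono (past_le hw t) le_rfl).snd
  obtain ⟨Ψ, hΨ⟩ : ∃ Ψ : M × ℝ → Ω → ℝ, ∀ z a,
      Ψ z a = z.2 * inner ℝ (mgrad m F z.1) (mgrad m (fun y => f y a) z.1) :=
    ⟨_, fun _ _ => rfl⟩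
  have hΨm : Measurable (Function.uncurry Ψ) := by
    have h := (measurable_snd.comp (measurable_fst (α := M × ℝ) (β := Ω))).mul
      ((hf.measurable_inner_section hR (hf.continuous_mgrad_integral hR (μ := μ))).comp
        ((measurable_fst.comp (measurable_fst (α := M × ℝ) (β := Ω))).prodMk measurable_snd))
    have e : Function.uncurry Ψ = fun q : (M × ℝ) × Ω =>
      q.1.2 * inner ℝ (mgrad m F q.1.1) (mgrad m (fun y => f y q.2) q.1.1) :=
      funext fun q => hΨ _ _
    rw [e]
    exact h
  have hΨi : ∀ t, Integrable (fun ξ => Ψ (X t ξ, H t ξ) (w t ξ)) P := by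
    intro t
    refine Integrable.of_bound (C := κ * (B * B))
      (hΨm.comp (((hXm t).prodMk (hHm t)).prodMk (hw t))).aestronglyMeasurable
      (Eventually.of_forall fun ξ => ?_)
    simp only [hΨ]
    rw [norm_mul, Real.norm_of_nonneg (hH0 t ξ)]
    exact mul_le_mul (hHκ t ξ) ((norm_inner_le_norm _ _).trans
      (mul_le_mul (hFB _ (hXK t ξ)) (hB _ (hXK t ξ) _) (norm_nonneg _) hB0.le))
      (norm_nonneg _) hκ0
  have hΨE : ∀ t, ∫ ξ, Ψ (X t ξ, H t ξ) (w t ξ) ∂P =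
      ∫ ξ, H t ξ * ‖mgrad m F (X t ξ)‖ ^ 2 ∂P := by
    intro t
    rw [integral_comp_eq_of_indepFun (X := fun ξ => (X t ξ, H t ξ)) ((hXm t).prodMk (hHm t)) (hw t)
      (indepFun_of_measurable_past hw hind (hmeas t)) hΨm (hΨi t), hlaw t]
    congr 1
    ext ξ
    simp only [hΨ]
    rw [integral_const_mul, ← real_inner_self_eq_norm_sq]
    congr 1
    conv_rhs => rw [hF, hf.inner_mgrad_integral hR]
    simp only [real_inner_comm, hF]
  have hdesc : ∀ t ξ, Ψ (X t ξ, H t ξ) (w t ξ) ≤ F (X t ξ) - F (X (t + 1) ξ) +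
      C * (H t ξ ^ 2 * ‖mgrad m (fun y => f y (w t ξ)) (X t ξ)‖ ^ 2) := by
    intro t ξ
    have hn : ‖-(H t ξ • mgrad m (fun y => f y (w t ξ)) (X t ξ))‖ =
        H t ξ * ‖mgrad m (fun y => f y (w t ξ)) (X t ξ)‖ := by
      rw [norm_neg, norm_smul, Real.norm_of_nonneg (hH0 t ξ)]
    have h1 := hC (X t ξ) (hXK t ξ) (-(H t ξ • mgrad m (fun y => f y (w t ξ)) (X t ξ))) (by
      rw [hn]
      have := mul_le_mul (hHκ t ξ) (hB _ (hXK t ξ) (w t ξ)) (norm_nonneg _) hκ0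
      linarith)
    rw [← hstep, hn, inner_neg_right, inner_smul_right, mul_pow] at h1
    simp only [hΨ, hF]
    linarith
  obtain ⟨b, hb⟩ : ∃ b : M → ℝ, ∀ x, ‖mgrad m F x‖ = b x := ⟨_, fun _ => rfl⟩
  have hbm : Measurable b := by
    have h := (hf.continuous_norm_mgrad_integral hR μ).measurable
    rwa [funext hb] at h
  have hb0 : ∀ x, 0 ≤ b x := fun x => hb x ▸ norm_nonneg _
  simp only [hb] at hFB hΨE ⊢
  refine ae_summable_of_sum_integral_le (Y := fun t ξ => H t ξ * b (X t ξ) ^ 2)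
    (c := 2 * D + C * c)
    (fun t ξ => mul_nonneg (hH0 t ξ) (sq_nonneg _)) (fun t => ?_) fun n => ?_
  · refine Integrable.of_bound (C := κ * B ^ 2)
      ((hHm t).mul ((hbm.comp (hXm t)).pow_const 2)).aestronglyMeasurable
      (Eventually.of_forall fun ξ => ?_)
    rw [Real.norm_of_nonneg (mul_nonneg (hH0 t ξ) (sq_nonneg _))]
    exact mul_le_mul (hHκ t ξ) (pow_le_pow_left₀ (hb0 _) (hFB _ (hXK t ξ)) 2) (sq_nonneg _) hκ0
  · simp_rw [← hΨE]
    rw [← integral_finsetSum _ fun t _ => hΨi t]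
    have h1 : ∀ ξ, ∑ t ∈ Finset.range n, Ψ (X t ξ, H t ξ) (w t ξ) ≤ 2 * D + C * c := by
      intro ξ
      have h2 : ∑ t ∈ Finset.range n, Ψ (X t ξ, H t ξ) (w t ξ) ≤
          F (X 0 ξ) - F (X n ξ) + C * ∑ t ∈ Finset.range n,
            H t ξ ^ 2 * ‖mgrad m (fun y => f y (w t ξ)) (X t ξ)‖ ^ 2 := by
        rw [Finset.mul_sum, ← Finset.sum_range_sub' (fun t => F (X t ξ)),
          ← Finset.sum_add_distrib]
        exact Finset.sum_le_sum fun t _ => hdesc t ξ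
      have h3 := abs_le.1 (hFD _ (hXK 0 ξ))
      have h4 := abs_le.1 (hFD _ (hXK n ξ))
      have h5 := mul_le_mul_of_nonneg_left (hc ξ n) hC0.le
      linarith [h3.2, h4.1]
    calc ∫ ξ, ∑ t ∈ Finset.range n, Ψ (X t ξ, H t ξ) (w t ξ) ∂P ≤ ∫ _, (2 * D + C * c) ∂P :=
          integral_mono (integrable_finsetSum _ fun t _ => hΨi t) (integrable_const _) h1
      _ = 2 * D + C * c := by simp

/-- Along iterates in a compact set with steps of length `O(η_t)`, a nonnegative continuous `b` with
`∑ η_t = ∞` and `∑ η_t b(x_t)² < ∞` tends to `0`. The separating sequence is `φ (x_t)` for a smooth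
`φ : M → [0, 1]` that is `0` on `{b ≤ δ}` and `1` on `{2δ ≤ b}`. -/
theorem IsRetraction.tendsto_zero_of_summable (hR : IsRetraction 2 R) {K : Set M}
    (hK : IsCompact K) {b : M → ℝ} (hb : Continuous b) (hb0 : ∀ x, 0 ≤ b x) {x : ℕ → M}
    {g : ∀ t, TangentSpace (𝓡 m) (x t)} {η : ℕ → ℝ} {B : ℝ} (hη : ∀ t, 0 ≤ η t)
    (hxK : ∀ t, x t ∈ K) (hg : ∀ t, ‖g t‖ ≤ B)
    (hstep : ∀ t, x (t + 1) = retrAt R (x t) (-(η t • g t))) (hdiv : ¬ Summable η)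
    (hsum : Summable fun t => η t * b (x t) ^ 2) :
    Tendsto (fun t => b (x t)) atTop (𝓝 0) := by
  have := ChartedSpace.locallyCompactSpace (EuclideanSpace ℝ (Fin m)) M
  refine tendsto_zero_of_summable_mul_sq (fun t => hb0 _) hη hdiv hsum fun δ hδ => ?_
  obtain ⟨φ, hφ0, hφ1, hφ⟩ := exists_contMDiffMap_zero_one_of_isClosed (𝓡 m) (n := 1)
    (isClosed_le hb (continuous_const (y := δ))) (isClosed_le (continuous_const (y := 2 * δ)) hb)
    (Set.disjoint_left.2 fun y (h1 : b y ≤ δ) (h2 : 2 * δ ≤ b y) => by linarith)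
  obtain ⟨L, hL⟩ := hR.exists_abs_sub_le φ.contMDiff hφ hK
  refine ⟨fun t => φ (x t), |L| * B, fun t ht => hφ0 ht, fun t ht => hφ1 ht, fun t => ?_⟩
  have h1 := hL (x t) (hxK t) (-(η t • g t))
  rw [← hstep, norm_neg, norm_smul, Real.norm_of_nonneg (hη t)] at h1
  calc |φ (x (t + 1)) - φ (x t)| ≤ |L| * (η t * ‖g t‖) :=
        h1.trans (mul_le_mul_of_nonneg_right (le_abs_self L)
          (mul_nonneg (hη t) (norm_nonneg _)))
    _ ≤ |L| * (η t * B) := by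
        have := hη t
        have := hg t
        gcongr
    _ = |L| * B * η t := by ring

end Convergence

end AdaSGD

theorem theorem2p5 {m : ℕ} {M : Type*} [TopologicalSpace M] [T2Space M]
    [SecondCountableTopology M] [ChartedSpace (EuclideanSpace ℝ (Fin m)) M]
    [IsManifold (𝓡 m) ∞ M]
    [RiemannianBundle (fun x : M => TangentSpace (𝓡 m) x)]
    [IsContMDiffRiemannianBundle (𝓡 m) ∞ (EuclideanSpace ℝ (Fin m))
      (fun x : M => TangentSpace (𝓡 m) x)]
    (R : TangentBundle (𝓡 m) M → M) (hR : AdaSGD.IsRetraction 2 R)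
    {Ω : Type*} [MeasurableSpace Ω] (μ : Measure Ω) [IsProbabilityMeasure μ]
    (f : M → Ω → ℝ) (hf_meas : ∀ x, Measurable (f x))
    (hf_diff : AdaSGD.DifferentiableInM m f)
    (hf_bdd : AdaSGD.LocallyBounded f)
    (hgrad_bdd : AdaSGD.LocallyBounded
      (fun (x : M) (a : Ω) => ‖AdaSGD.mgrad m (fun y => f y a) x‖))
    (hf_lip : AdaSGD.LocallyRLipschitzGradient R f)
    (F : M → ℝ) (hF : ∀ x, F x = ∫ a, f x a ∂μ)
    (κ : ℝ) (hκ : 0 < κ) (ρ : M → ℝ) (ρ₀ ρ₁ : ℝ)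
    (hρ : AdaSGD.IsConfinementWith R f κ ρ ρ₀ ρ₁)
    {S : Type*} [MeasurableSpace S] (P : Measure S) [IsProbabilityMeasure P]
    (w : ℕ → S → Ω) (hw_meas : ∀ t, Measurable (w t)) (hw_indep : iIndepFun w P)
    (hw_law : ∀ t, P.map (w t) = μ)
    (x₀ : M) (hx₀ : ρ x₀ ≤ ρ₁)
    (ε α β : ℝ) (hε : 0 < ε) (hε' : ε ≤ 1 / 2) (hα : 0 < α) (hβ : 0 < β)
    (hαβ : α / β ^ (1 / 2 + ε) ≤ κ)
    (x : ℕ → S → M) (hx : ∀ t ξ, x t ξ = AdaSGD.sgd R f α β ε x₀ (fun s => w s ξ) t) :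
    -- the iterates stay in the compact set `K₁`, and so have convergent subsequences
    (IsCompact {y : M | ρ y ≤ ρ₁} ∧ (∀ t ξ, x t ξ ∈ {y : M | ρ y ≤ ρ₁}) ∧
      ∀ ξ, ∃ y ∈ {y : M | ρ y ≤ ρ₁}, ∃ φ : ℕ → ℕ, StrictMono φ ∧
        Tendsto (fun k => x (φ k) ξ) atTop (𝓝 y)) ∧
    -- `F` is differentiable, and its gradient tends to `0` along almost every trajectory
    MDifferentiable (𝓡 m) 𝓘(ℝ, ℝ) F ∧
    (∀ᵐ ξ ∂P, Tendsto (fun t => ‖AdaSGD.mgrad m F (x t ξ)‖) atTop (𝓝 0)) ∧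
    -- almost surely, every limit point of the iterates is a stationary point of `F`
    (∀ᵐ ξ ∂P, ∀ y : M, MapClusterPt y atTop (fun t => x t ξ) → AdaSGD.IsStationaryPoint m F y) := by

  have hf : AdaSGD.IsRegularIntegrand R f := ⟨hf_meas, hf_diff, hf_bdd, hgrad_bdd, hf_lip⟩
  obtain rfl : F = fun y => ∫ a, f y a ∂μ := funext hF
  have hsgd : ∀ ξ, AdaSGD.sgd R f α β ε x₀ (fun s => w s ξ) = fun t => x t ξ :=
    fun ξ => funext fun t => (hx t ξ).symm
  obtain ⟨η, hη⟩ : ∃ η : ℕ → S → ℝ, ∀ t ξ,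
      AdaSGD.stepSize m f α β ε (fun s => w s ξ) (fun t => x t ξ) t = η t ξ :=
    ⟨_, fun _ _ => rfl⟩
  have hη0 : ∀ t ξ, 0 ≤ η t ξ := fun t ξ => by
    rw [← hη]
    exact (AdaSGD.stepSize_pos hα hβ _ _ t).le
  have hηκ : ∀ t ξ, η t ξ ≤ κ := fun t ξ => by
    rw [← hη]
    exact (AdaSGD.stepSize_le hα hβ hε _ _ t).trans hαβ
  have hstep : ∀ t ξ, x (t + 1) ξ = AdaSGD.retrAt R (x t ξ)
      (-(η t ξ • AdaSGD.mgrad m (fun y => f y (w t ξ)) (x t ξ))) := fun t ξ => by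
    have h := AdaSGD.sgd_succ R f α β ε x₀ (fun s => w s ξ) t
    rw [hsgd ξ] at h
    rw [← hη]
    exact h
  have hmet := AdaSGD.metrizableSpace_of_chartedSpace m M
  let _ : MeasurableSpace M := borel M
  have _ : BorelSpace M := ⟨rfl⟩
  have hmeas : ∀ t, Measurable[AdaSGD.past w t] fun ξ => (x t ξ, η t ξ) := fun t => by
    have h := hf.measurable_sgd hR α β ε x₀ w t
    simp only [hsgd, ← hx, hη] at h
    exact h
  set K : Set M := {y : M | ρ y ≤ ρ₁} with hKdef
  have hK : IsCompact K := hρ.isCompact_sublevel ρ₁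
  have hmem : ∀ t ξ, x t ξ ∈ K := fun t ξ => by
    rw [hx]
    exact hρ.sgd_le hR hκ hα hβ hε hαβ hx₀ _ t
  obtain ⟨B, hB0, hB⟩ := hgrad_bdd K hK
  simp only [abs_norm] at hB
  obtain ⟨q, hq⟩ : ∃ q : S → ℕ → ℝ, ∀ ξ t,
      ‖AdaSGD.mgrad m (fun y => f y (w t ξ)) (x t ξ)‖ ^ 2 = q ξ t := ⟨_, fun _ _ => rfl⟩
  have hq0 : ∀ ξ t, 0 ≤ q ξ t := fun ξ t => by
    rw [← hq]
    positivity
  have hqB : ∀ ξ t, q ξ t ≤ B ^ 2 := fun ξ t => by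
    rw [← hq]
    exact pow_le_pow_left₀ (norm_nonneg _) (hB _ (hmem t ξ) _) 2
  have hηq : ∀ ξ t, η t ξ = α / (β + ∑ s ∈ Finset.range t, q ξ s) ^ (1 / 2 + ε) := fun ξ t => by
    rw [← hη, AdaSGD.stepSize]
    simp only [hq]
  have hcont := hf.continuous_norm_mgrad_integral hR μ
  have hsum := hf.ae_summable_mul_sq hR hw_meas hw_indep hw_law hK hmeas hmem hstep hη0 hηκ
    (c := α ^ 2 * ((1 + B ^ 2 / β) ^ (1 + 2 * ε) * β ^ (-(2 * ε)) / (2 * ε))) (fun ξ n => by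
      simp only [hq]
      refine le_trans (le_of_eq ?_) (mul_le_mul_of_nonneg_left (AdaSGD.sum_div_rpow_le
        (hq0 ξ) (hqB ξ) hβ (by positivity : 0 < 2 * ε) n) (sq_nonneg α))
      rw [Finset.mul_sum]
      refine Finset.sum_congr rfl fun t _ => ?_
      have hG : 0 ≤ β + ∑ s ∈ Finset.range t, q ξ s :=
        add_nonneg hβ.le (Finset.sum_nonneg fun _ _ => hq0 ξ _)
      rw [hηq, div_pow, ← Real.rpow_mul_natCast hG,
        show (1 / 2 + ε) * ((2 : ℕ) : ℝ) = 1 + 2 * ε by push_cast; ring]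
      ring)
  have htend : ∀ᵐ ξ ∂P, Tendsto (fun t => ‖AdaSGD.mgrad m (fun y => ∫ a, f y a ∂μ) (x t ξ)‖)
      atTop (𝓝 0) := by
    filter_upwards [hsum] with ξ hξ
    refine hR.tendsto_zero_of_summable hK hcont (fun _ => norm_nonneg _)
      (fun t => hη0 t ξ) (fun t => hmem t ξ) (fun t => hB _ (hmem t ξ) (w t ξ))
      (fun t => hstep t ξ) ?_ hξ
    simp only [hηq]
    exact AdaSGD.not_summable_div_rpow (hq0 ξ) (hqB ξ) hα hβ (by positivity) (by linarith)
  have hFd := hf.mdifferentiable_integral hR (μ := μ)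
  refine ⟨⟨hK, hmem, fun ξ => hK.tendsto_subseq fun t => hmem t ξ⟩, hFd, htend, ?_⟩
  filter_upwards [htend] with ξ hξ y hy
  refine ⟨hFd y, ?_⟩
  have h1 := hy.continuousAt_comp hcont.continuousAt
  exact norm_eq_zero.1 (eq_of_nhds_neBot (ClusterPt.mono h1 hξ))
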